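/- Let $n\ge 1$, $0<s<1$, $1<p<\infty$. For a measurable $u\colon\mathbb R^n\to\mathbb R$ put $[u]_{s,p}=\Big(\int_{\mathbb R^{2n}}\frac{|u(x)-u(y)|^p}{|x-y|^{n+sp}}\,dx\,dy\Big)^{1/p}$ and $\|u\|_{s,p}=\big(\|u\|_{L^p(\mathbb R^n)}^p+[u]_{s,p}^p\big)^{1/p}$; let $W^{s,p}(\mathbb R^n)$ be the space of $u\in L^p(\mathbb R^n)$ with $[u]_{s,p}<\infty$, and for an open set $U\subset\mathbb R^n$ let $\widetilde W^{s,p}(U)$ be the closure of $C_c^\infty(U)$ in $W^{s,p}(\mathbb R^n)$. Let $\Omega\subset\mathbb R^n$ be a bounded open set and let $W\subset\Omega_e:=\mathbb R^n\setminus\overline\Omega$ be a nonempty open set. For $j=1,2$ let $\sigma_j\colon\mathbb R^n\times\mathbb R^n\to\mathbb R$ be measurable such that (a) there is $\lambda_j>0$ with $\lambda_j\le\sigma_j(x,y)\le\lambda_j^{-1}$ for all $x,y\in\mathbb R^n$; (b) for every $x_0\in W$ the family $(\sigma_j(x,\cdot)\colon W\to\mathbb R)_{x\in\mathbb R^n}$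 is equicontinuous at $x_0$, and $\sigma_j(\cdot,x_0)$ is continuous on $W$. Set $\Sigma_j(x)=\sigma_j(x,x)$. For $f\in W^{s,p}(\mathbb R^n)$ let $u_f^{(j)}\in W^{s,p}(\mathbb R^n)$ be the unique function with $u_f^{(j)}-f\in\widetilde W^{s,p}(\Omega)$ and $$\int_{\mathbb R^{2n}}\sigma_j(x,y)\,|u(x)-u(y)|^{p-2}\,\frac{(u(x)-u(y))(\varphi(x)-\varphi(y))}{|x-y|^{n+sp}}\,dx\,dy=0\quad\text{for all }\varphi\in C_c^\infty(\Omega),\qquad u=u_f^{(j)},$$ and define the Dirichlet-to-Neumann map $\Lambda_{\sigma_j}$ by $$\langle\Lambda_{\sigma_j}f,g\rangle=\int_{\mathbb R^{2n}}\sigma_j(x,y)\,|u_f^{(j)}(x)-u_f^{(j)}(y)|^{p-2}\,\frac{(u_f^{(j)}(x)-u_f^{(j)}(y))(g(x)-g(y))}{|x-y|^{n+sp}}\,dx\,dy .$$ Then $$\|\Sigma_1-\Sigma_2\|_{L^\infty(W)}\le\|\Lambda_{\sigma_1}-\Lambda_{\sigma_2}\|_{\widetilde W^{s,p}(W)\to(\widetilde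 W^{s,p}(W))^*},$$ where the right-hand side is the operator norm $\sup\{|\langle\Lambda_{\sigma_1}f-\Lambda_{\sigma_2}f,g\rangle| : f,g\in\widetilde W^{s,p}(W),\ \|f\|_{s,p}\le1,\ \|g\|_{s,p}\le 1\}$ (equivalently, since the maps are homogeneous of degree $p-1$, the supremum of $|\langle\Lambda_{\sigma_1}f-\Lambda_{\sigma_2}f,g\rangle|/(\|f\|_{s,p}^{p-1}\|g\|_{s,p})$ over nonzero $f,g\in\widetilde W^{s,p}(W)$). -/

import Mathlib

open MeasureTheory
open scoped ENNReal

namespace FracPLap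

/-- The measure `dμ = dx dy / |x - y|ⁿ` on `ℝⁿ × ℝⁿ` (the diagonal is a null set). -/
noncomputable def offDiagMeasure (n : ℕ) :
    Measure (EuclideanSpace ℝ (Fin n) × EuclideanSpace ℝ (Fin n)) :=
  volume.withDensity fun z => ENNReal.ofReal (‖z.1 - z.2‖ ^ n)⁻¹

/-- The fractional `s`-gradient `d_s u (x, y) = (u x - u y) / |x - y|ˢ`. -/
noncomputable def fracGrad {n : ℕ} (s : ℝ) (u : EuclideanSpace ℝ (Fin n) → ℝ)
    (z : EuclideanSpace ℝ (Fin n) × EuclideanSpace ℝ (Fin n)) : ℝ :=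
  (u z.1 - u z.2) / ‖z.1 - z.2‖ ^ s

/-- The Gagliardo seminorm
`[u]_{W^{s,p}(ℝⁿ)} = (∫∫ |u x - u y|ᵖ / |x - y|^(n + s p) dx dy)^(1/p)`,
that is, the `Lᵖ(μ)` norm of `d_s u`; it takes values in `[0, ∞]`. -/
noncomputable def gagliardo {n : ℕ} (s p : ℝ) (u : EuclideanSpace ℝ (Fin n) → ℝ) : ℝ≥0∞ :=
  eLpNorm (fracGrad s u) (ENNReal.ofReal p) (offDiagMeasure n)

/-- The norm `‖u‖_{W^{s,p}(ℝⁿ)} = (‖u‖_{Lᵖ}ᵖ + [u]ᵖ)^(1/p)`, with values in `[0, ∞]`. -/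
noncomputable def sobolevNorm {n : ℕ} (s p : ℝ) (u : EuclideanSpace ℝ (Fin n) → ℝ) : ℝ≥0∞ :=
  (eLpNorm u (ENNReal.ofReal p) volume ^ p + gagliardo s p u ^ p) ^ (1 / p)

/-- (Representatives of) the elements of the fractional Sobolev space `W^{s,p}(ℝⁿ)`. -/
def SobolevSpace (n : ℕ) (s p : ℝ) : Set (EuclideanSpace ℝ (Fin n) → ℝ) :=
  {u | MemLp u (ENNReal.ofReal p) volume ∧ gagliardo s p u < ⊤}

/-- The test functions `C_c^∞(U)`, extended by zero to `ℝⁿ`. -/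
def TestFun {n : ℕ} (U : Set (EuclideanSpace ℝ (Fin n))) :
    Set (EuclideanSpace ℝ (Fin n) → ℝ) :=
  {φ | ContDiff ℝ (⊤ : ℕ∞) φ ∧ HasCompactSupport φ ∧ tsupport φ ⊆ U}

/-- The space `W̃^{s,p}(U)`: the closure of `C_c^∞(U)` in `W^{s,p}(ℝⁿ)`. -/
def SobolevTilde {n : ℕ} (s p : ℝ) (U : Set (EuclideanSpace ℝ (Fin n))) :
    Set (EuclideanSpace ℝ (Fin n) → ℝ) :=
  {u | u ∈ SobolevSpace n s p ∧
    ∀ ε : ℝ≥0∞, 0 < ε → ∃ φ ∈ TestFun U, sobolevNorm s p (u - φ) < ε}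

/-- The weak form `⟨Div_s(σ |d_s u|^(p-2) d_s u), φ⟩ = ∫ σ |d_s u|^(p-2) d_s u d_s φ dμ`. -/
noncomputable def weakForm {n : ℕ} (s p : ℝ)
    (σ : EuclideanSpace ℝ (Fin n) → EuclideanSpace ℝ (Fin n) → ℝ)
    (u φ : EuclideanSpace ℝ (Fin n) → ℝ) : ℝ :=
  ∫ z, σ z.1 z.2 * |fracGrad s u z| ^ (p - 2) * fracGrad s u z * fracGrad s φ z ∂(offDiagMeasure n)

/-- `u ∈ W^{s,p}(ℝⁿ)` is a weak solution of `Div_s(σ |d_s u|^(p-2) d_s u) = 0` in `Ω`,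
`u = f` in the exterior: it is a distributional solution and `u - f ∈ W̃^{s,p}(Ω)`. -/
structure IsWeakSolution {n : ℕ} (s p : ℝ) (Ω : Set (EuclideanSpace ℝ (Fin n)))
    (σ : EuclideanSpace ℝ (Fin n) → EuclideanSpace ℝ (Fin n) → ℝ)
    (f u : EuclideanSpace ℝ (Fin n) → ℝ) : Prop where
  mem : u ∈ SobolevSpace n s p
  weak : ∀ φ ∈ TestFun Ω, weakForm s p σ u φ = 0
  exterior : u - f ∈ SobolevTilde s p Ω

/-- The weak solution `u_f` with exterior value `f` (for uniformly elliptic measurable `σ`,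
bounded open `Ω` and `f ∈ W^{s,p}(ℝⁿ)` it exists and is unique up to a null set). -/
noncomputable def solution {n : ℕ} (s p : ℝ) (Ω : Set (EuclideanSpace ℝ (Fin n)))
    (σ : EuclideanSpace ℝ (Fin n) → EuclideanSpace ℝ (Fin n) → ℝ)
    (f : EuclideanSpace ℝ (Fin n) → ℝ) : EuclideanSpace ℝ (Fin n) → ℝ :=
  Classical.epsilon fun u => IsWeakSolution s p Ω σ f u

/-- The Dirichlet-to-Neumann map:
`⟨Λ_σ f, g⟩ = ∫ σ |d_s u_f|^(p-2) d_s u_f d_s g dμ`. -/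
noncomputable def dnMap {n : ℕ} (s p : ℝ) (Ω : Set (EuclideanSpace ℝ (Fin n)))
    (σ : EuclideanSpace ℝ (Fin n) → EuclideanSpace ℝ (Fin n) → ℝ)
    (f g : EuclideanSpace ℝ (Fin n) → ℝ) : ℝ :=
  weakForm s p σ (solution s p Ω σ f) g

/-- The norm of a functional in `(W̃^{s,p}(U))^*`: the supremum of `|⟨ℓ, g⟩|` over the
unit ball of `W̃^{s,p}(U)`, with values in `[0, ∞]`. -/
noncomputable def dualNorm {n : ℕ} (s p : ℝ) (U : Set (EuclideanSpace ℝ (Fin n)))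
    (ℓ : (EuclideanSpace ℝ (Fin n) → ℝ) → ℝ) : ℝ≥0∞ :=
  ⨆ g ∈ {g | g ∈ SobolevTilde s p U ∧ sobolevNorm s p g ≤ 1}, ‖ℓ g‖ₑ

/-- The operator norm of a (possibly nonlinear) `T : W̃^{s,p}(U) → (W̃^{s,p}(U))^*`: the supremum
of `‖T f‖` over the unit ball of `W̃^{s,p}(U)`. If `T` is positively homogeneous of degree
`p - 1 > 0`, this is `sup_{f ≠ 0} ‖T f‖ / ‖f‖^(p-1)`. -/
noncomputable def operatorNorm {n : ℕ} (s p : ℝ) (U : Set (EuclideanSpace ℝ (Fin n)))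
    (T : (EuclideanSpace ℝ (Fin n) → ℝ) → (EuclideanSpace ℝ (Fin n) → ℝ) → ℝ) : ℝ≥0∞ :=
  ⨆ f ∈ {f | f ∈ SobolevTilde s p U ∧ sobolevNorm s p f ≤ 1}, dualNorm s p U (T f)

/-- The hypotheses on a coefficient `σ`: (Lebesgue) measurability, uniform ellipticity, and, at
every `x₀ ∈ W`, equicontinuity of the family `(σ(x, ·) : W → ℝ)`, `x ∈ ℝⁿ`, together with
`σ(·, x₀) ∈ C(W)`. -/
structure Admissible {n : ℕ} (W : Set (EuclideanSpace ℝ (Fin n)))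
    (σ : EuclideanSpace ℝ (Fin n) → EuclideanSpace ℝ (Fin n) → ℝ) : Prop where
  measurable : AEMeasurable
    (fun z : EuclideanSpace ℝ (Fin n) × EuclideanSpace ℝ (Fin n) => σ z.1 z.2) volume
  elliptic : ∃ c : ℝ, 0 < c ∧ ∀ x y, c ≤ σ x y ∧ σ x y ≤ c⁻¹
  equicontinuous : ∀ x₀ ∈ W, EquicontinuousWithinAt σ W x₀
  continuous : ∀ x₀ ∈ W, ContinuousOn (fun x => σ x x₀) W

end FracPLap

namespace FracPLap

open Filter Topology

theorem rpow_abs_midpoint_lt {p : ℝ} (hp : 1 < p) {a b : ℝ} (hab : a ≠ b) :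
    |(a + b) / 2| ^ p < (|a| ^ p + |b| ^ p) / 2 := by
  by_cases h : |a| = |b|
  · have hb : a = -b := by
      rcases abs_eq_abs.1 h with h | h
      · exact absurd h hab
      · exact h
    subst hb
    have hb0 : b ≠ 0 := by
      rintro rfl
      simp at hab
    have : 0 < |b| ^ p := Real.rpow_pos_of_pos (abs_pos.2 hb0) p
    simp only [neg_add_cancel, zero_div, abs_zero, abs_neg]
    rw [Real.zero_rpow (by linarith)]
    linarith
  · have h1 := (strictConvexOn_rpow hp).2 (abs_nonneg a) (abs_nonneg b) h
      (by norm_num : (0 : ℝ) < 1 / 2) (by norm_num : (0 : ℝ) < 1 / 2) (by norm_num)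
    simp only [smul_eq_mul] at h1
    have h2 : |(a + b) / 2| ≤ 1 / 2 * |a| + 1 / 2 * |b| := by
      rw [abs_div, abs_two]
      have := abs_add_le a b
      linarith
    have h3 := Real.rpow_le_rpow (abs_nonneg _) h2 (by linarith : 0 ≤ p)
    linarith

theorem rpow_abs_midpoint_le {p : ℝ} (hp : 1 < p) (a b : ℝ) :
    |(a + b) / 2| ^ p ≤ (|a| ^ p + |b| ^ p) / 2 := by
  by_cases hab : a = b
  · subst hab
    simp
  · exact (rpow_abs_midpoint_lt hp hab).le

theorem rpow_abs_sub_le {p : ℝ} (hp : 1 < p) (a b : ℝ) :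
    |a - b| ^ p ≤ 2 ^ p * (|a| ^ p + |b| ^ p) := by
  have h := rpow_abs_midpoint_le hp a (-b)
  rw [abs_neg, ← sub_eq_add_neg, abs_div, abs_two, Real.div_rpow (abs_nonneg _) (by norm_num)] at h
  have h2 : (0 : ℝ) < 2 ^ p := by positivity
  rw [div_le_iff₀ h2] at h
  have h3 : 0 ≤ 2 ^ p * (|a| ^ p + |b| ^ p) := by positivity
  linarith

/-- A quantitative form of the uniform convexity of `Lᵖ`, at the level of integrands. -/
theorem exists_rpow_abs_sub_le_gap {p : ℝ} (hp : 1 < p) {ε : ℝ} (hε : 0 < ε) :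
    ∃ C : ℝ, 0 ≤ C ∧ ∀ a b : ℝ, |a - b| ^ p ≤ ε * (|a| ^ p + |b| ^ p) +
      C * ((|a| ^ p + |b| ^ p) / 2 - |(a + b) / 2| ^ p) := by
  have hp0 : 0 < p := by linarith
  have hcont : ∀ g : ℝ × ℝ → ℝ, Continuous g → Continuous fun z => |g z| ^ p := fun g hg =>
    hg.abs.rpow_const fun _ => Or.inr hp0.le
  have hc1 := hcont (fun z => z.1) continuous_fst
  have hc2 := hcont (fun z => z.2) continuous_snd
  have hc3 := hcont (fun z => z.1 - z.2) (continuous_fst.sub continuous_snd)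
  have hc4 := hcont (fun z => (z.1 + z.2) / 2) ((continuous_fst.add continuous_snd).div_const 2)
  let S : Set (ℝ × ℝ) := {z | |z.1| ^ p + |z.2| ^ p = 1} ∩ {z | ε ≤ |z.1 - z.2| ^ p}
  have hScl : IsClosed S :=
    (isClosed_eq (hc1.add hc2) continuous_const).inter (isClosed_le continuous_const hc3)
  have hSc : IsCompact S := by
    refine Metric.isCompact_of_isClosed_isBounded hScl ?_
    refine (Metric.isBounded_closedBall (x := (0 : ℝ × ℝ)) (r := 1)).subset ?_
    rintro ⟨a, b⟩ ⟨h, -⟩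
    simp only [Set.mem_ofPred_eq] at h
    have key : ∀ x : ℝ, |x| ^ p ≤ 1 → |x| ≤ 1 := fun x hx => by
      by_contra hlt
      exact absurd hx (not_le.2 (Real.one_lt_rpow (not_le.1 hlt) hp0))
    have ha : 0 ≤ |a| ^ p := by positivity
    have hb : 0 ≤ |b| ^ p := by positivity
    rw [mem_closedBall_zero_iff, Prod.norm_def]
    exact max_le (key a (by linarith)) (key b (by linarith))
  obtain ⟨δ, hδ, hS⟩ : ∃ δ : ℝ, 0 < δ ∧ ∀ z ∈ S,
      δ ≤ (|z.1| ^ p + |z.2| ^ p) / 2 - |(z.1 + z.2) / 2| ^ p := by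
    rcases S.eq_empty_or_nonempty with h | h
    · exact ⟨1, one_pos, by simp [h]⟩
    · obtain ⟨z, hz, hmin⟩ := hSc.exists_isMinOn h
        (((hc1.add hc2).div_const 2).sub hc4).continuousOn
      refine ⟨_, ?_, fun w hw => hmin hw⟩
      have hne : z.1 ≠ z.2 := by
        intro he
        have := hz.2
        simp only [Set.mem_ofPred_eq, he, sub_self, abs_zero, Real.zero_rpow hp0.ne'] at this
        linarith
      exact sub_pos.2 (rpow_abs_midpoint_lt hp hne)
  refine ⟨2 ^ p / δ, by positivity, fun a b => ?_⟩
  have hgap := rpow_abs_midpoint_le hp a b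
  have hC : 0 ≤ 2 ^ p / δ := by positivity
  by_cases hle : |a - b| ^ p ≤ ε * (|a| ^ p + |b| ^ p)
  · have := mul_nonneg hC (sub_nonneg.2 hgap)
    linarith
  push Not at hle
  set N := |a| ^ p + |b| ^ p with hN
  have hN0 : 0 < N := by
    have h0 : 0 ≤ N := by positivity
    rcases h0.lt_or_eq with h | h
    · exact h
    · have := rpow_abs_sub_le hp a b
      rw [← hN, ← h] at this
      rw [← h] at hle
      linarith
  set t := N ^ (-p⁻¹) with ht
  have ht0 : 0 < t := by positivity
  have htp : t ^ p = N⁻¹ := by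
    rw [ht, ← Real.rpow_mul hN0.le, neg_mul, inv_mul_cancel₀ hp0.ne', Real.rpow_neg_one]
  have hsc : ∀ x : ℝ, |t * x| ^ p = N⁻¹ * |x| ^ p := fun x => by
    rw [abs_mul, Real.mul_rpow (abs_nonneg _) (abs_nonneg _), abs_of_pos ht0, htp]
  have hmem : (t * a, t * b) ∈ S := by
    constructor
    · simp only [Set.mem_ofPred_eq, hsc]
      rw [← mul_add, inv_mul_cancel₀ hN0.ne']
    · simp only [Set.mem_ofPred_eq]
      rw [← mul_sub, hsc, inv_mul_eq_div, le_div_iff₀ hN0]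
      exact hle.le
  have h1 := hS _ hmem
  simp only at h1
  rw [show (t * a + t * b) / 2 = t * ((a + b) / 2) by ring, hsc, hsc, hsc, ← mul_add, mul_div_assoc,
    ← mul_sub, inv_mul_eq_div, le_div_iff₀ hN0] at h1
  have h2 := rpow_abs_sub_le hp a b
  rw [← hN] at h2
  have h3 : 2 ^ p * N = 2 ^ p / δ * (δ * N) := by
    field_simp
  have h4 := mul_le_mul_of_nonneg_left h1 hC
  have h5 : 0 ≤ ε * N := by positivity
  linarith

theorem rpow_abs_mul_self {p : ℝ} (hp : 1 < p) (a : ℝ) : |a| ^ (p - 2) * a * a = |a| ^ p := by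
  rw [mul_assoc, ← abs_mul_abs_self]
  rcases eq_or_ne a 0 with rfl | ha
  · simp [Real.zero_rpow (by linarith : p ≠ 0)]
  · have h := abs_pos.2 ha
    rw [← pow_two, ← Real.rpow_natCast, ← Real.rpow_add h]
    norm_num

theorem abs_rpow_mul {p : ℝ} (hp : 1 < p) (a : ℝ) : |(|a| ^ (p - 2) * a)| = |a| ^ (p - 1) := by
  rw [abs_mul, abs_of_nonneg (by positivity : 0 ≤ |a| ^ (p - 2))]
  rcases eq_or_ne a 0 with rfl | ha
  · simp [Real.zero_rpow (by linarith : p - 1 ≠ 0)]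
  · have h := abs_pos.2 ha
    nth_rewrite 2 [← Real.rpow_one |a|]
    rw [← Real.rpow_add h]
    congr 1
    ring

theorem continuous_rpow_mul {p : ℝ} (hp : 1 < p) : Continuous fun a : ℝ => |a| ^ (p - 2) * a := by
  rw [continuous_iff_continuousAt]
  intro a
  rcases eq_or_ne a 0 with rfl | ha
  · have h : Tendsto (fun a : ℝ => |a| ^ (p - 1)) (𝓝 0) (𝓝 0) := by
      have : Continuous fun a : ℝ => |a| ^ (p - 1) :=
        continuous_abs.rpow_const fun _ => Or.inr (by linarith)
      have h2 := this.tendsto 0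
      rwa [abs_zero, Real.zero_rpow (by linarith)] at h2
    rw [ContinuousAt, mul_zero]
    refine squeeze_zero_norm (fun x => ?_) h
    rw [Real.norm_eq_abs, abs_rpow_mul hp]
  · exact (continuousAt_id.abs.rpow_const (Or.inl (abs_ne_zero.2 ha))).mul continuousAt_id

theorem abs_rpow_mul_mul_le {p : ℝ} (hp : 1 < p) (a b : ℝ) :
    |(|a| ^ (p - 2) * a * b)| ≤ (1 - 1 / p) * |a| ^ p + 1 / p * |b| ^ p := by
  rw [abs_mul, abs_rpow_mul hp]
  have hpq : (p / (p - 1)).HolderConjugate p := (Real.HolderConjugate.conjExponent hp).symm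
  have h := Real.young_inequality_of_nonneg (a := |a| ^ (p - 1)) (b := |b|) (by positivity)
    (abs_nonneg b) hpq
  rw [← Real.rpow_mul (abs_nonneg a), mul_div_cancel₀ _ (by linarith : p - 1 ≠ 0)] at h
  calc _ ≤ _ := h
    _ = _ := by
      have : p ≠ 0 := by linarith
      have : p - 1 ≠ 0 := by linarith
      field_simp

section Lp

variable {Z : Type*} [MeasurableSpace Z] {m : Measure Z} {p : ℝ}

theorem integrable_abs_rpow (hp : 1 < p) {A : Z → ℝ} (hA : MemLp A (ENNReal.ofReal p) m) :
    Integrable (fun z => |A z| ^ p) m := by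
  have h := hA.integrable_norm_rpow (by simp; linarith) ENNReal.ofReal_ne_top
  simpa [ENNReal.toReal_ofReal (by linarith : 0 ≤ p)] using h

theorem integral_abs_rpow (hp : 1 < p) {A : Z → ℝ} (hA : MemLp A (ENNReal.ofReal p) m) :
    ∫ z, |A z| ^ p ∂m = (eLpNorm A (ENNReal.ofReal p) m).toReal ^ p := by
  have h := hA.eLpNorm_eq_integral_rpow_norm (by simp; linarith) ENNReal.ofReal_ne_top
  have h0 : 0 ≤ ∫ z, |A z| ^ p ∂m := integral_nonneg fun z => by positivity
  simp only [ENNReal.toReal_ofReal (by linarith : 0 ≤ p), Real.norm_eq_abs] at h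
  rw [h, ENNReal.toReal_ofReal (by positivity), ← Real.rpow_mul h0,
    inv_mul_cancel₀ (by linarith), Real.rpow_one]

theorem ofReal_integral_abs_rpow (hp : 1 < p) {A : Z → ℝ} (hA : MemLp A (ENNReal.ofReal p) m) :
    ENNReal.ofReal (∫ z, |A z| ^ p ∂m) = eLpNorm A (ENNReal.ofReal p) m ^ p := by
  rw [integral_abs_rpow hp hA, ← ENNReal.ofReal_rpow_of_nonneg ENNReal.toReal_nonneg (by linarith),
    ENNReal.ofReal_toReal hA.2.ne]

theorem eLpNorm_rpow_eq_lintegral (hp : 1 < p) (A : Z → ℝ) :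
    eLpNorm A (ENNReal.ofReal p) m ^ p = ∫⁻ z, ENNReal.ofReal (|A z| ^ p) ∂m := by
  have hp0 : 0 < p := by linarith
  rw [eLpNorm_eq_lintegral_rpow_enorm_toReal (by simp; linarith) ENNReal.ofReal_ne_top,
    ENNReal.toReal_ofReal hp0.le, ← ENNReal.rpow_mul, one_div, inv_mul_cancel₀ hp0.ne',
    ENNReal.rpow_one]
  refine lintegral_congr fun z => ?_
  rw [Real.enorm_eq_ofReal_abs, ENNReal.ofReal_rpow_of_nonneg (abs_nonneg _) hp0.le]

theorem aestronglyMeasurable_rpow_mul (hp : 1 < p) {A B : Z → ℝ}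
    (hA : AEStronglyMeasurable A m) (hB : AEStronglyMeasurable B m) :
    AEStronglyMeasurable (fun z => |A z| ^ (p - 2) * A z * B z) m :=
  ((continuous_rpow_mul hp).comp_aestronglyMeasurable hA).mul hB

theorem integrable_rpow_mul (hp : 1 < p) {A B : Z → ℝ} (hA : MemLp A (ENNReal.ofReal p) m)
    (hB : MemLp B (ENNReal.ofReal p) m) :
    Integrable (fun z => |A z| ^ (p - 2) * A z * B z) m :=
  Integrable.mono' (((integrable_abs_rpow hp hA).const_mul (1 - 1 / p)).add
    ((integrable_abs_rpow hp hB).const_mul (1 / p)))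
    (aestronglyMeasurable_rpow_mul hp hA.1 hB.1)
    (Eventually.of_forall fun z => abs_rpow_mul_mul_le hp (A z) (B z))

theorem abs_integral_rpow_mul_le (hp : 1 < p) {A B : Z → ℝ} (hA : MemLp A (ENNReal.ofReal p) m)
    (hB : MemLp B (ENNReal.ofReal p) m) :
    |∫ z, |A z| ^ (p - 2) * A z * B z ∂m| ≤
      (1 - 1 / p) * ∫ z, |A z| ^ p ∂m + 1 / p * ∫ z, |B z| ^ p ∂m := by
  have hi := ((integrable_abs_rpow hp hA).const_mul (1 - 1 / p))
  have hj := ((integrable_abs_rpow hp hB).const_mul (1 / p))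
  refine (abs_integral_le_integral_abs).trans ?_
  rw [← integral_const_mul, ← integral_const_mul, ← integral_add hi hj]
  exact integral_mono (integrable_rpow_mul hp hA hB).abs (hi.add hj)
    fun z => abs_rpow_mul_mul_le hp (A z) (B z)

/-- The kernel of the weak pairing `B ↦ ∫ |A|^(p-2) A B` is closed in `Lᵖ`. -/
theorem integral_rpow_mul_eq_zero_of_approx (hp : 1 < p) {A B : Z → ℝ}
    (hA : MemLp A (ENNReal.ofReal p) m) (hB : MemLp B (ENNReal.ofReal p) m)
    (happ : ∀ ε : ℝ, 0 < ε → ∃ D : Z → ℝ, MemLp D (ENNReal.ofReal p) m ∧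
      ∫ z, |A z| ^ (p - 2) * A z * D z ∂m = 0 ∧ ∫ z, |B z - D z| ^ p ∂m ≤ ε) :
    ∫ z, |A z| ^ (p - 2) * A z * B z ∂m = 0 := by
  set F := ∫ z, |A z| ^ (p - 2) * A z * B z ∂m with hF
  set J := ∫ z, |A z| ^ p ∂m with hJ
  have hp0 : 0 < p := by linarith
  have hp1 : 1 / p ≤ 1 := by rw [div_le_one hp0]; exact hp.le
  have hp2 : 0 ≤ 1 / p := by positivity
  have hJ0 : 0 ≤ J := integral_nonneg fun z => by positivity
  have key : ∀ t : ℝ, 0 < t → t * |F| ≤ J + 1 := by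
    intro t ht
    obtain ⟨D, hD, hD0, hBD⟩ := happ (t ^ p)⁻¹ (by positivity)
    have hBD' : MemLp (fun z => B z - D z) (ENNReal.ofReal p) m := hB.sub hD
    have h1 := abs_integral_rpow_mul_le hp hA (hBD'.const_mul t)
    have h2 : ∫ z, |A z| ^ (p - 2) * A z * (t * (B z - D z)) ∂m = t * F := by
      have : ∀ z, |A z| ^ (p - 2) * A z * (t * (B z - D z)) =
        t * (|A z| ^ (p - 2) * A z * B z - |A z| ^ (p - 2) * A z * D z) := fun z => by ring
      simp_rw [this]
      rw [integral_const_mul, integral_sub (integrable_rpow_mul hp hA hB)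
        (integrable_rpow_mul hp hA hD), hD0, sub_zero]
    have h3 : ∫ z, |t * (B z - D z)| ^ p ∂m ≤ 1 := by
      simp_rw [abs_mul, Real.mul_rpow (abs_nonneg _) (abs_nonneg _), abs_of_pos ht]
      rw [integral_const_mul]
      have : 0 < t ^ p := by positivity
      calc _ ≤ t ^ p * (t ^ p)⁻¹ := by gcongr
        _ = 1 := mul_inv_cancel₀ this.ne'
    have h4 : 0 ≤ ∫ z, |t * (B z - D z)| ^ p ∂m := integral_nonneg fun z => by positivity
    rw [h2, abs_mul, abs_of_pos ht] at h1
    nlinarith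
  by_contra hne
  have hpos : 0 < |F| := abs_pos.2 hne
  have h5 := key ((J + 2) / |F|) (by positivity)
  rw [div_mul_cancel₀ _ hpos.ne'] at h5
  linarith

theorem integral_rpow_mul_self (hp : 1 < p) (A : Z → ℝ) :
    ∫ z, |A z| ^ (p - 2) * A z * A z ∂m = ∫ z, |A z| ^ p ∂m := by
  simp_rw [rpow_abs_mul_self hp]

theorem tendsto_integral_rpow_of_tendsto_eLpNorm (hp : 1 < p) {a : ℕ → Z → ℝ} {A : Z → ℝ}
    (ha : ∀ k, MemLp (a k) (ENNReal.ofReal p) m) (hA : MemLp A (ENNReal.ofReal p) m)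
    (h : Tendsto (fun k => eLpNorm (a k - A) (ENNReal.ofReal p) m) atTop (𝓝 0)) :
    Tendsto (fun k => ∫ z, |a k z| ^ p ∂m) atTop (𝓝 (∫ z, |A z| ^ p ∂m)) := by
  have : Fact (1 ≤ ENNReal.ofReal p) := ⟨by simpa using hp.le⟩
  have h1 := ((Lp.tendsto_Lp_iff_tendsto_eLpNorm'' a ha A hA).2 h).norm
  simp only [Lp.norm_toLp] at h1
  simp_rw [integral_abs_rpow hp hA, integral_abs_rpow hp (ha _)]
  exact h1.rpow_const (Or.inr (by linarith))

/-- Minimizing sequences of the `p`-energy are Cauchy sequences. -/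
theorem exists_forall_integral_rpow_sub_le (hp : 1 < p) {a : ℕ → Z → ℝ} {I : ℝ}
    (ha : ∀ k, MemLp (a k) (ENNReal.ofReal p) m)
    (hlim : Tendsto (fun k => ∫ z, |a k z| ^ p ∂m) atTop (𝓝 I))
    (hmid : ∀ j k, I ≤ ∫ z, |(a j z + a k z) / 2| ^ p ∂m) {ε : ℝ} (hε : 0 < ε) :
    ∃ N, ∀ j k, N ≤ j → N ≤ k → ∫ z, |a j z - a k z| ^ p ∂m ≤ ε := by
  have hI0 : 0 ≤ I := ge_of_tendsto' hlim fun k => integral_nonneg fun z => by positivity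
  obtain ⟨C, hC, hgap⟩ := exists_rpow_abs_sub_le_gap hp
    (by positivity : 0 < ε / (4 * (I + 1)))
  set η := min 1 (ε / (2 * (C + 1))) with hη
  have hη0 : 0 < η := lt_min one_pos (by positivity)
  obtain ⟨N, hN⟩ := eventually_atTop.1 (hlim.eventually_lt_const (by linarith : I < I + η))
  refine ⟨N, fun j k hj hk => ?_⟩
  have hmem : MemLp (fun z => (a j z + a k z) / 2) (ENNReal.ofReal p) m := by
    have := ((ha j).add (ha k)).const_mul (1 / 2)
    refine this.congr_norm (this.1.congr ?_) ?_
    all_goals exact Eventually.of_forall fun z => by simp; ring_nf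
  have ij := integrable_abs_rpow hp (ha j)
  have ik := integrable_abs_rpow hp (ha k)
  have im := integrable_abs_rpow hp hmem
  have i1 := (ij.add ik).const_mul (ε / (4 * (I + 1)))
  have i2 := (((ij.add ik).div_const 2).sub im).const_mul C
  have h1 := integral_mono (integrable_abs_rpow hp ((ha j).sub (ha k))) (i1.add i2)
    (fun z => hgap (a j z) (a k z))
  have h2 : ∫ z, (fun z => ε / (4 * (I + 1)) * ((fun z => |a j z| ^ p) + fun z => |a k z| ^ p) z) z +
      (fun z => C * ((fun z => ((fun z => |a j z| ^ p) + fun z => |a k z| ^ p) z / 2) -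
        fun z => |(a j z + a k z) / 2| ^ p) z) z ∂m = 
      ε / (4 * (I + 1)) * (∫ z, |a j z| ^ p ∂m + ∫ z, |a k z| ^ p ∂m) +
      C * ((∫ z, |a j z| ^ p ∂m + ∫ z, |a k z| ^ p ∂m) / 2 - ∫ z, |(a j z + a k z) / 2| ^ p ∂m) := by
    rw [integral_add i1 i2, integral_const_mul, integral_const_mul]
    congr 2
    · exact integral_add ij ik
    · rw [integral_sub' ((ij.add ik).div_const 2) im, integral_div]
      congr 2
      exact integral_add ij ik
  have h3 := h1.trans_eq h2
  have hNj := hN j hj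
  have hNk := hN k hk
  have hm := hmid j k
  have hη1 : η ≤ 1 := min_le_left _ _
  have hη2 : η * (2 * (C + 1)) ≤ ε := (le_div_iff₀ (by positivity)).1 (min_le_right _ _)
  have h4 : ε / (4 * (I + 1)) * (∫ z, |a j z| ^ p ∂m + ∫ z, |a k z| ^ p ∂m) ≤
      ε / (4 * (I + 1)) * (2 * (I + 1)) := by
    gcongr
    linarith
  have h5 : ε / (4 * (I + 1)) * (2 * (I + 1)) = ε / 2 := by
    field_simp
    norm_num
  have h6 : C * ((∫ z, |a j z| ^ p ∂m + ∫ z, |a k z| ^ p ∂m) / 2 -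
      ∫ z, |(a j z + a k z) / 2| ^ p ∂m) ≤ C * η := by
    gcongr
    linarith
  refine h3.trans ?_
  nlinarith

/-- One-sided first variation of the `p`-energy at a minimizer. -/
theorem integral_rpow_mul_nonneg_of_min (hp : 1 < p) {A B : Z → ℝ}
    (hA : MemLp A (ENNReal.ofReal p) m) (hB : MemLp B (ENNReal.ofReal p) m)
    (hmin : ∀ t : ℝ, ∫ z, |A z| ^ p ∂m ≤ ∫ z, |A z + t * B z| ^ p ∂m) :
    0 ≤ ∫ z, |A z| ^ (p - 2) * A z * B z ∂m := by
  have hp0 : 0 < p := by linarith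
  have hmem : ∀ t : ℝ, MemLp (fun z => A z + t * B z) (ENNReal.ofReal p) m := fun t =>
    hA.add (hB.const_mul t)
  have hpos : ∀ t : ℝ, 0 < t →
      0 ≤ ∫ z, |A z + t * B z| ^ (p - 2) * (A z + t * B z) * B z ∂m := by
    intro t ht
    have h1 := le_of_abs_le (abs_integral_rpow_mul_le hp (hmem t) hA)
    have h2 : ∫ z, |A z + t * B z| ^ (p - 2) * (A z + t * B z) * A z ∂m =
        ∫ z, |A z + t * B z| ^ p ∂m -
          t * ∫ z, |A z + t * B z| ^ (p - 2) * (A z + t * B z) * B z ∂m := by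
      rw [← integral_const_mul, ← integral_sub (integrable_abs_rpow hp (hmem t))
        ((integrable_rpow_mul hp (hmem t) hB).const_mul t)]
      congr 1
      ext z
      rw [← rpow_abs_mul_self hp]
      ring
    rw [h2] at h1
    have h3 := hmin t
    have hp2 : 0 < 1 / p := by positivity
    have h4 : 0 ≤ t * ∫ z, |A z + t * B z| ^ (p - 2) * (A z + t * B z) * B z ∂m := by
      nlinarith
    exact nonneg_of_mul_nonneg_right h4 ht
  have hlim : Tendsto (fun k : ℕ => ∫ z, |A z + 1 / ((k : ℝ) + 1) * B z| ^ (p - 2) *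
      (A z + 1 / ((k : ℝ) + 1) * B z) * B z ∂m) atTop
      (𝓝 (∫ z, |A z| ^ (p - 2) * A z * B z ∂m)) := by
    have hAB : MemLp (fun z => |A z| + |B z|) (ENNReal.ofReal p) m := hA.abs.add hB.abs
    refine tendsto_integral_of_dominated_convergence
      (fun z => (1 - 1 / p) * |(|A z| + |B z|)| ^ p + 1 / p * |B z| ^ p)
      (fun k => (integrable_rpow_mul hp (hmem _) hB).1)
      (((integrable_abs_rpow hp hAB).const_mul _).add ((integrable_abs_rpow hp hB).const_mul _))
      (fun k => Eventually.of_forall fun z => ?_) (Eventually.of_forall fun z => ?_)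
    · refine (abs_rpow_mul_mul_le hp _ _).trans ?_
      have hp2 : 0 ≤ 1 - 1 / p := by
        rw [sub_nonneg, div_le_one hp0]
        exact hp.le
      have hk : |1 / ((k : ℝ) + 1)| ≤ 1 := by
        rw [abs_of_pos (by positivity), div_le_one (by positivity)]
        linarith [(Nat.cast_nonneg k : (0 : ℝ) ≤ k)]
      have hle : |A z + 1 / ((k : ℝ) + 1) * B z| ≤ |(|A z| + |B z|)| :=
        calc |A z + 1 / ((k : ℝ) + 1) * B z| ≤ |A z| + |1 / ((k : ℝ) + 1)| * |B z| := by
              rw [← abs_mul]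
              exact abs_add_le _ _
          _ ≤ |A z| + 1 * |B z| := by gcongr
          _ = |A z| + |B z| := by rw [one_mul]
          _ ≤ _ := le_abs_self _
      have := mul_le_mul_of_nonneg_left (Real.rpow_le_rpow (abs_nonneg _) hle hp0.le) hp2
      linarith
    · have h1 : Tendsto (fun k : ℕ => A z + 1 / ((k : ℝ) + 1) * B z) atTop (𝓝 (A z)) := by
        have := (tendsto_one_div_add_atTop_nhds_zero_nat (𝕜 := ℝ)).mul_const (B z)
        simpa using this.const_add (A z)
      exact (((continuous_rpow_mul hp).tendsto _).comp h1).mul_const _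
  exact ge_of_tendsto' hlim fun k => hpos _ (by positivity)

end Lp

/-- The kernel `|x|^-(n + s p)` of the Gagliardo seminorm. -/
noncomputable def kernel {n : ℕ} (s p : ℝ) (x : EuclideanSpace ℝ (Fin n)) : ℝ≥0∞ :=
  ENNReal.ofReal (‖x‖ ^ (-(n + s * p)))

section Kernel

variable {n : ℕ} {s p : ℝ}

theorem measurable_kernel : Measurable (kernel (n := n) s p) :=
  ENNReal.measurable_ofReal.comp (measurable_norm.pow_const _)

theorem setLIntegral_fracGrad (hp : 1 < p) (u : EuclideanSpace ℝ (Fin n) → ℝ)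
    {S : Set (EuclideanSpace ℝ (Fin n) × EuclideanSpace ℝ (Fin n))} (hS : MeasurableSet S) :
    ∫⁻ z in S, ENNReal.ofReal (|fracGrad s u z| ^ p) ∂(offDiagMeasure n) =
      ∫⁻ z in S, ENNReal.ofReal (|u z.1 - u z.2| ^ p) * kernel s p (z.1 - z.2) := by
  rw [offDiagMeasure, restrict_withDensity hS, lintegral_withDensity_eq_lintegral_mul_non_measurable]
  · refine lintegral_congr fun z => ?_
    rw [Pi.mul_apply, kernel, ← ENNReal.ofReal_mul (by positivity),
      ← ENNReal.ofReal_mul (by positivity)]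
    congr 1
    rcases eq_or_ne z.1 z.2 with h | h
    · simp [fracGrad, h, Real.zero_rpow (by linarith : p ≠ 0)]
    · have hpos : 0 < ‖z.1 - z.2‖ := norm_pos_iff.2 (sub_ne_zero.2 h)
      rw [fracGrad, abs_div, Real.div_rpow (abs_nonneg _) (abs_nonneg _),
        abs_of_nonneg (Real.rpow_nonneg hpos.le s), ← Real.rpow_mul hpos.le, Real.rpow_neg hpos.le,
        Real.rpow_add hpos, Real.rpow_natCast]
      field_simp
  · fun_prop
  · exact Eventually.of_forall fun z => ENNReal.ofReal_lt_top

theorem gagliardo_rpow (hp : 1 < p) (u : EuclideanSpace ℝ (Fin n) → ℝ) :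
    gagliardo s p u ^ p =
      ∫⁻ z : EuclideanSpace ℝ (Fin n) × EuclideanSpace ℝ (Fin n),
        ENNReal.ofReal (|u z.1 - u z.2| ^ p) * kernel s p (z.1 - z.2) := by
  rw [gagliardo, eLpNorm_rpow_eq_lintegral hp]
  simpa using setLIntegral_fracGrad (s := s) hp u MeasurableSet.univ

theorem lintegral_mul_comp_sub {V : Type*} [NormedAddCommGroup V] [NormedSpace ℝ V]
    [FiniteDimensional ℝ V] [MeasureSpace V] [BorelSpace V] [(volume : Measure V).IsAddHaarMeasure]
    {a h : V → ℝ≥0∞} (ha : Measurable a) (hh : Measurable h) :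
    ∫⁻ z : V × V, a z.1 * h (z.1 - z.2) = (∫⁻ x, a x) * ∫⁻ x, h x := by
  rw [Measure.volume_eq_prod, lintegral_prod _ (by fun_prop)]
  have hm : ∀ x, Measurable fun y => h (x - y) := fun x => by fun_prop
  simp_rw [lintegral_const_mul _ (hm _),
    lintegral_sub_left_eq_self h]
  rw [lintegral_mul_const _ ha]

theorem lintegral_mul_comp_sub' {V : Type*} [NormedAddCommGroup V] [NormedSpace ℝ V]
    [FiniteDimensional ℝ V] [MeasureSpace V] [BorelSpace V] [(volume : Measure V).IsAddHaarMeasure]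
    {a h : V → ℝ≥0∞} (ha : Measurable a) (hh : Measurable h) :
    ∫⁻ z : V × V, a z.2 * h (z.1 - z.2) = (∫⁻ x, a x) * ∫⁻ x, h x := by
  rw [Measure.volume_eq_prod, lintegral_prod_symm _ (by fun_prop)]
  have hm : ∀ y, Measurable fun x => h (x - y) := fun y => by fun_prop
  simp_rw [lintegral_const_mul _ (hm _),
    lintegral_sub_right_eq_self h]
  rw [lintegral_mul_const _ ha]

theorem lintegral_kernel_far_lt_top (hs : 0 < s) (hp : 1 < p) {d : ℝ} (hd : 0 < d) :
    ∫⁻ x in {x : EuclideanSpace ℝ (Fin n) | d ≤ ‖x‖}, kernel s p x < ⊤ := by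
  have hsp : 0 < s * p := mul_pos hs (by linarith)
  have hr : (0 : ℝ) ≤ n + s * p := by positivity
  have hint := (integrable_one_add_norm (E := EuclideanSpace ℝ (Fin n)) (μ := volume)
    (r := n + s * p) (by simpa using hsp)).const_mul ((1 / d + 1) ^ ((n : ℝ) + s * p))
  refine lt_of_le_of_lt ?_ hint.lintegral_lt_top
  refine (setLIntegral_mono' (measurableSet_le measurable_const measurable_norm)
    (g := fun x => ENNReal.ofReal ((1 / d + 1) ^ ((n : ℝ) + s * p) *
      (1 + ‖x‖) ^ (-(n + s * p)))) fun x hx => ?_).trans (setLIntegral_le_lintegral _ _)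
  have hx' : d ≤ ‖x‖ := hx
  have hx0 : 0 < ‖x‖ := hd.trans_le hx'
  refine ENNReal.ofReal_le_ofReal ?_
  rw [Real.rpow_neg hx0.le, Real.rpow_neg (by positivity), ← div_eq_mul_inv,
    ← Real.div_rpow (by positivity) (by positivity), ← Real.inv_rpow hx0.le]
  refine Real.rpow_le_rpow (by positivity) ?_ hr
  rw [le_div_iff₀ (by positivity), inv_mul_le_iff₀ hx0]
  have : 1 ≤ ‖x‖ * (1 / d) := by
    rw [mul_one_div, one_le_div hd]
    exact hx'
  linarith

theorem lintegral_kernel_near_lt_top (hn : 1 ≤ n) (hs1 : s < 1) (hp : 1 < p) :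
    ∫⁻ x in {x : EuclideanSpace ℝ (Fin n) | ‖x‖ < 1},
      ENNReal.ofReal (‖x‖ ^ p) * kernel s p x < ⊤ := by
  have : Nonempty (Fin n) := ⟨⟨0, hn⟩⟩
  have : Nontrivial (EuclideanSpace ℝ (Fin n)) := inferInstance
  let g : ℝ → ℝ := Set.indicator (Set.Iio 1) fun r => r ^ p * r ^ (-(n + s * p))
  have hg : Integrable (fun x : EuclideanSpace ℝ (Fin n) => g ‖x‖) volume := by
    rw [integrable_fun_norm_addHaar]
    have h1 : IntegrableOn (fun r : ℝ => r ^ (p * (1 - s) - 1)) (Set.Ioo 0 1) volume := by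
      have := intervalIntegral.intervalIntegrable_rpow' (a := 0) (b := 1)
        (by nlinarith : (-1 : ℝ) < p * (1 - s) - 1)
      rw [intervalIntegrable_iff_integrableOn_Ioo_of_le zero_le_one] at this
      exact this
    have h2 : IntegrableOn (Set.indicator (Set.Iio 1) fun r : ℝ => r ^ (p * (1 - s) - 1))
        (Set.Ioi 0) volume := by
      rw [IntegrableOn, integrable_indicator_iff measurableSet_Iio, IntegrableOn,
        Measure.restrict_restrict measurableSet_Iio, Set.Iio_inter_Ioi]
      exact h1
    refine h2.congr_fun (fun r hr => ?_) measurableSet_Ioi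
    have hr0 : 0 < r := hr
    by_cases hr1 : r < 1
    · simp only [g, Set.indicator_of_mem (show r ∈ Set.Iio 1 from hr1), finrank_euclideanSpace,
        Fintype.card_fin, smul_eq_mul]
      rw [← Real.rpow_natCast, ← Real.rpow_add hr0, ← Real.rpow_add hr0, Nat.cast_sub hn]
      congr 1
      push_cast
      ring
    · simp [g, hr1]
  refine lt_of_le_of_lt (le_of_eq ?_) hg.lintegral_lt_top
  rw [← lintegral_indicator (measurableSet_lt measurable_norm measurable_const)]
  refine lintegral_congr fun x => ?_
  by_cases hx : ‖x‖ < 1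
  · rw [Set.indicator_of_mem (show x ∈ {x | ‖x‖ < 1} from hx)]
    simp only [g, Set.indicator_of_mem (show ‖x‖ ∈ Set.Iio (1 : ℝ) from hx)]
    rw [ENNReal.ofReal_mul (by positivity), kernel]
  · simp [g, hx]

end Kernel

section TestFun

variable {n : ℕ} {s p : ℝ} {U : Set (EuclideanSpace ℝ (Fin n))}

theorem TestFun.eq_zero {φ : EuclideanSpace ℝ (Fin n) → ℝ} (hφ : φ ∈ TestFun U)
    {x : EuclideanSpace ℝ (Fin n)} (hx : x ∉ U) : φ x = 0 :=
  image_eq_zero_of_notMem_tsupport fun h => hx (hφ.2.2 h)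

theorem TestFun.add {φ ψ : EuclideanSpace ℝ (Fin n) → ℝ} (hφ : φ ∈ TestFun U)
    (hψ : ψ ∈ TestFun U) : φ + ψ ∈ TestFun U :=
  ⟨hφ.1.add hψ.1, hφ.2.1.add hψ.2.1,
    (tsupport_add φ ψ).trans (Set.union_subset hφ.2.2 hψ.2.2)⟩

theorem TestFun.const_smul {φ : EuclideanSpace ℝ (Fin n) → ℝ} (hφ : φ ∈ TestFun U) (c : ℝ) :
    c • φ ∈ TestFun U :=
  ⟨contDiff_const.smul hφ.1, hφ.2.1.smul_left (f := fun _ => c),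
    (tsupport_smul_subset_right (fun _ => c) φ).trans hφ.2.2⟩

theorem TestFun.sub {φ ψ : EuclideanSpace ℝ (Fin n) → ℝ} (hφ : φ ∈ TestFun U)
    (hψ : ψ ∈ TestFun U) : φ - ψ ∈ TestFun U := by
  have := TestFun.add hφ (TestFun.const_smul hψ (-1))
  rwa [neg_one_smul, ← sub_eq_add_neg] at this

theorem TestFun.zero_mem : (0 : EuclideanSpace ℝ (Fin n) → ℝ) ∈ TestFun U :=
  ⟨contDiff_const, HasCompactSupport.zero, by simp [tsupport]⟩

theorem TestFun.gagliardo_lt_top (hn : 1 ≤ n) (hs0 : 0 < s) (hs1 : s < 1) (hp : 1 < p)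
    {φ : EuclideanSpace ℝ (Fin n) → ℝ} (hφ : φ ∈ TestFun U) : gagliardo s p φ < ⊤ := by
  have hp0 : 0 < p := by linarith
  obtain ⟨L, hL⟩ := ContDiff.lipschitzWith_of_hasCompactSupport hφ.2.1 hφ.1 (by simp)
  obtain ⟨M, hM⟩ := hφ.2.1.exists_bound_of_continuous hφ.1.continuous
  have hM0 : 0 ≤ M := (norm_nonneg _).trans (hM 0)
  let h : EuclideanSpace ℝ (Fin n) → ℝ≥0∞ := fun x =>
    ENNReal.ofReal ((L : ℝ) ^ p) *
      {x | ‖x‖ < 1}.indicator (fun x => ENNReal.ofReal (‖x‖ ^ p) * kernel s p x) x +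
    ENNReal.ofReal ((2 * M) ^ p) * {x | 1 ≤ ‖x‖}.indicator (kernel s p) x
  have hms1 : MeasurableSet {x : EuclideanSpace ℝ (Fin n) | ‖x‖ < 1} :=
    measurableSet_lt measurable_norm measurable_const
  have hms2 : MeasurableSet {x : EuclideanSpace ℝ (Fin n) | 1 ≤ ‖x‖} :=
    measurableSet_le measurable_const measurable_norm
  have hmk := measurable_kernel (n := n) (s := s) (p := p)
  have hm1 : Measurable ({x : EuclideanSpace ℝ (Fin n) | ‖x‖ < 1}.indicator
      (fun x => ENNReal.ofReal (‖x‖ ^ p) * kernel s p x)) :=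
    (((measurable_norm.pow_const p).ennreal_ofReal).mul hmk).indicator hms1
  have hm2 : Measurable ({x : EuclideanSpace ℝ (Fin n) | 1 ≤ ‖x‖}.indicator (kernel s p)) :=
    hmk.indicator hms2
  have hhm : Measurable h := (hm1.const_mul _).add (hm2.const_mul _)
  have hhi : ∫⁻ x, h x < ⊤ := by
    simp only [h]
    rw [lintegral_add_left (hm1.const_mul _), lintegral_const_mul _ hm1, lintegral_const_mul _ hm2,
      lintegral_indicator hms1, lintegral_indicator hms2]
    exact ENNReal.add_lt_top.2 ⟨ENNReal.mul_lt_top ENNReal.ofReal_lt_top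
      (lintegral_kernel_near_lt_top hn hs1 hp), ENNReal.mul_lt_top ENNReal.ofReal_lt_top
      (lintegral_kernel_far_lt_top hs0 hp one_pos)⟩
  have hK : MeasurableSet (tsupport φ) := (isClosed_tsupport φ).measurableSet
  let a : EuclideanSpace ℝ (Fin n) → ℝ≥0∞ := (tsupport φ).indicator 1
  have ham : Measurable a := measurable_one.indicator hK
  have hai : ∫⁻ x, a x < ⊤ := by
    simp only [a]
    rw [lintegral_indicator_one hK]
    exact hφ.2.1.isCompact.measure_lt_top
  have hbound : ∀ z : EuclideanSpace ℝ (Fin n) × EuclideanSpace ℝ (Fin n),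
      ENNReal.ofReal (|φ z.1 - φ z.2| ^ p) * kernel s p (z.1 - z.2) ≤
        a z.1 * h (z.1 - z.2) + a z.2 * h (z.1 - z.2) := by
    rintro ⟨x, y⟩
    have hh : ENNReal.ofReal (|φ x - φ y| ^ p) * kernel s p (x - y) ≤ h (x - y) := by
      by_cases hxy : ‖x - y‖ < 1
      · have h1 : |φ x - φ y| ≤ L * ‖x - y‖ := by
          simpa [dist_eq_norm] using hL.dist_le_mul x y
        simp only [h]
        rw [Set.indicator_of_mem (show x - y ∈ {x | ‖x‖ < 1} from hxy)]
        refine le_add_right ?_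
        rw [← mul_assoc, ← ENNReal.ofReal_mul (by positivity),
          ← Real.mul_rpow (by positivity) (by positivity)]
        gcongr
      · have h1 : |φ x - φ y| ≤ 2 * M := by
          have := (abs_sub (φ x) (φ y))
          have h2 := hM x
          have h3 := hM y
          rw [Real.norm_eq_abs] at h2 h3
          linarith
        simp only [h]
        rw [Set.indicator_of_mem (show x - y ∈ {x | 1 ≤ ‖x‖} from not_lt.1 hxy)]
        refine le_add_left ?_
        gcongr
    by_cases hx : x ∈ tsupport φ
    · have : a x = 1 := by simp [a, hx]
      simp only [this, one_mul]
      exact le_add_right hh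
    · by_cases hy : y ∈ tsupport φ
      · have : a y = 1 := by simp [a, hy]
        simp only [this, one_mul]
        exact le_add_left hh
      · simp [image_eq_zero_of_notMem_tsupport hx, image_eq_zero_of_notMem_tsupport hy,
          Real.zero_rpow hp0.ne']
  have hfin : gagliardo s p φ ^ p < ⊤ := by
    rw [gagliardo_rpow hp]
    refine (lintegral_mono hbound).trans_lt ?_
    rw [lintegral_add_left (by fun_prop), lintegral_mul_comp_sub ham hhm,
      lintegral_mul_comp_sub' ham hhm]
    have := ENNReal.mul_lt_top hai hhi
    exact ENNReal.add_lt_top.2 ⟨this, this⟩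
  by_contra htop
  rw [not_lt_top_iff] at htop
  simp [htop, hp0] at hfin

theorem TestFun.mem_sobolevSpace (hn : 1 ≤ n) (hs0 : 0 < s) (hs1 : s < 1) (hp : 1 < p)
    {φ : EuclideanSpace ℝ (Fin n) → ℝ} (hφ : φ ∈ TestFun U) : φ ∈ SobolevSpace n s p :=
  ⟨hφ.1.continuous.memLp_of_hasCompactSupport hφ.2.1, TestFun.gagliardo_lt_top hn hs0 hs1 hp hφ⟩

end TestFun

section Estimates

variable {n : ℕ} {s p : ℝ}

/-- The Poincaré inequality for functions supported in a ball of radius `R`. -/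
theorem exists_poincare (hn : 1 ≤ n) (s : ℝ) (hp : 1 < p) :
    ∃ C : ℝ, 0 < C ∧ ∀ (x₀ : EuclideanSpace ℝ (Fin n)) (R : ℝ), 0 < R →
      ∀ f : EuclideanSpace ℝ (Fin n) → ℝ, Measurable f → (∀ x ∉ Metric.ball x₀ R, f x = 0) →
        0 ≤ s → eLpNorm f (ENNReal.ofReal p) volume ^ p ≤
          ENNReal.ofReal (C * R ^ (s * p)) * gagliardo s p f ^ p := by
  have hp0 : 0 < p := by linarith
  have : Nonempty (Fin n) := ⟨⟨0, hn⟩⟩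
  have : Nontrivial (EuclideanSpace ℝ (Fin n)) := inferInstance
  obtain ⟨e, he⟩ := exists_norm_eq (EuclideanSpace ℝ (Fin n)) zero_le_one
  set b := (volume (Metric.ball (0 : EuclideanSpace ℝ (Fin n)) 1)).toReal with hb
  have hbt : volume (Metric.ball (0 : EuclideanSpace ℝ (Fin n)) 1) ≠ ⊤ := measure_ball_lt_top.ne
  have hb0 : 0 < b := ENNReal.toReal_pos (Metric.measure_ball_pos _ _ one_pos).ne' hbt
  refine ⟨4 ^ ((n : ℝ) + s * p) / b, by positivity, fun x₀ R hR f hf hf0 hs => ?_⟩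
  have hsp : 0 ≤ s * p := by positivity
  let B' := Metric.ball (x₀ + (2 * R) • e) R
  have hvol : volume B' = ENNReal.ofReal (R ^ n * b) := by
    simp only [B']
    rw [Measure.addHaar_ball _ _ hR.le, ENNReal.ofReal_mul (by positivity), hb,
      ENNReal.ofReal_toReal hbt, finrank_euclideanSpace, Fintype.card_fin]
  have hdist : ∀ x ∈ Metric.ball x₀ R, ∀ y ∈ B', y ∉ Metric.ball x₀ R ∧ 0 < ‖x - y‖ ∧
      ‖x - y‖ ≤ 4 * R := by
    intro x hx y hy
    have h2 : dist (x₀ + (2 * R) • e) x₀ = 2 * R := by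
      rw [dist_eq_norm, add_sub_cancel_left, norm_smul, he, Real.norm_eq_abs,
        abs_of_pos (by positivity), mul_one]
    have hy' : dist y (x₀ + (2 * R) • e) < R := hy
    have hx' : dist x x₀ < R := hx
    have hy0 : y ∉ Metric.ball x₀ R := by
      intro h
      have h3 : dist y x₀ < R := h
      have := dist_triangle_left (x₀ + (2 * R) • e) x₀ y
      linarith
    refine ⟨hy0, ?_, ?_⟩
    · rw [norm_pos_iff, sub_ne_zero]
      rintro rfl
      exact hy0 hx
    · rw [← dist_eq_norm]
      have h4 := dist_triangle x x₀ y
      have h5 := dist_triangle y (x₀ + (2 * R) • e) x₀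
      rw [dist_comm y x₀] at h5
      linarith
  have hfm : Measurable fun x => ENNReal.ofReal (|f x| ^ p) := by fun_prop
  have hlow : ∫⁻ x, ENNReal.ofReal (|f x| ^ p) *
      ENNReal.ofReal ((4 * R) ^ (-((n : ℝ) + s * p)) * (R ^ n * b)) ≤ gagliardo s p f ^ p := by
    have hmk := measurable_kernel (n := n) (s := s) (p := p)
    rw [gagliardo_rpow hp, Measure.volume_eq_prod, lintegral_prod _ (by fun_prop)]
    refine lintegral_mono fun x => ?_
    by_cases hx : x ∈ Metric.ball x₀ R
    · refine le_trans ?_ (setLIntegral_le_lintegral B' _)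
      rw [ENNReal.ofReal_mul (by positivity), ← hvol, ← mul_assoc, ← setLIntegral_const]
      refine setLIntegral_mono' Metric.isOpen_ball.measurableSet fun y hy => ?_
      obtain ⟨hy0, hpos, hle⟩ := hdist x hx y hy
      simp only [hf0 y hy0, sub_zero, kernel]
      gcongr 2
      exact Real.rpow_le_rpow_of_nonpos hpos hle (neg_nonpos.2 (by positivity))
    · simp [hf0 x hx, Real.zero_rpow hp0.ne']
  rw [lintegral_mul_const _ hfm, ← eLpNorm_rpow_eq_lintegral hp] at hlow
  have hprod : 4 ^ ((n : ℝ) + s * p) / b * R ^ (s * p) *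
      ((4 * R) ^ (-((n : ℝ) + s * p)) * (R ^ n * b)) = 1 := by
    rw [Real.rpow_neg (by positivity), Real.mul_rpow (by norm_num) hR.le, Real.rpow_add hR,
      Real.rpow_natCast]
    field_simp
  calc eLpNorm f (ENNReal.ofReal p) volume ^ p
      = ENNReal.ofReal (4 ^ ((n : ℝ) + s * p) / b * R ^ (s * p)) *
        (eLpNorm f (ENNReal.ofReal p) volume ^ p *
          ENNReal.ofReal ((4 * R) ^ (-((n : ℝ) + s * p)) * (R ^ n * b))) := by
        rw [mul_left_comm, ← ENNReal.ofReal_mul (by positivity), hprod, ENNReal.ofReal_one, mul_one]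
    _ ≤ _ := by gcongr

/-- The part of the energy of a concentrated function that is far from the concentration point is
controlled by the `Lᵖ` norm. -/
theorem exists_lintegral_fracGrad_far_le (hs : 0 < s) (hp : 1 < p) {δ : ℝ} (hδ : 0 < δ) :
    ∃ C : ℝ, 0 ≤ C ∧ ∀ (x₀ : EuclideanSpace ℝ (Fin n)) (ε : ℝ), 2 * ε ≤ δ →
      ∀ f : EuclideanSpace ℝ (Fin n) → ℝ, Measurable f → (∀ x ∉ Metric.ball x₀ ε, f x = 0) →
        ∫⁻ z in (Metric.ball x₀ δ ×ˢ Metric.ball x₀ δ)ᶜ, ENNReal.ofReal (|fracGrad s f z| ^ p)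
          ∂(offDiagMeasure n) ≤ ENNReal.ofReal C * eLpNorm f (ENNReal.ofReal p) volume ^ p := by
  have hp0 : 0 < p := by linarith
  have hms : MeasurableSet {x : EuclideanSpace ℝ (Fin n) | δ / 2 ≤ ‖x‖} :=
    measurableSet_le measurable_const measurable_norm
  let h : EuclideanSpace ℝ (Fin n) → ℝ≥0∞ := {x | δ / 2 ≤ ‖x‖}.indicator (kernel s p)
  have hhm : Measurable h := measurable_kernel.indicator hms
  have hhi : ∫⁻ x, h x < ⊤ := by
    simp only [h]
    rw [lintegral_indicator hms]
    exact lintegral_kernel_far_lt_top hs hp (by positivity)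
  refine ⟨2 * (∫⁻ x, h x).toReal, by positivity, fun x₀ ε hε f hf hf0 => ?_⟩
  rw [setLIntegral_fracGrad hp f
    (Metric.isOpen_ball.measurableSet.prod Metric.isOpen_ball.measurableSet).compl,
    eLpNorm_rpow_eq_lintegral hp]
  let a : EuclideanSpace ℝ (Fin n) → ℝ≥0∞ := fun x => ENNReal.ofReal (|f x| ^ p)
  have ham : Measurable a := by fun_prop
  have hfar : ∀ x ∉ Metric.ball x₀ δ, ∀ y, f y ≠ 0 → δ / 2 ≤ ‖x - y‖ := by
    intro x hx y hy
    have hy' : y ∈ Metric.ball x₀ ε := by_contra fun h => hy (hf0 y h)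
    rw [Metric.mem_ball] at hx hy'
    rw [← dist_eq_norm]
    have := dist_triangle x y x₀
    linarith
  have hzero : ∀ x ∉ Metric.ball x₀ δ, f x = 0 := by
    intro x hx
    by_contra hne
    have := hfar x hx x hne
    rw [sub_self, norm_zero] at this
    linarith
  have hbound : ∀ z ∈ (Metric.ball x₀ δ ×ˢ Metric.ball x₀ δ)ᶜ,
      ENNReal.ofReal (|f z.1 - f z.2| ^ p) * kernel s p (z.1 - z.2) ≤
        a z.1 * h (z.1 - z.2) + a z.2 * h (z.1 - z.2) := by
    rintro ⟨x, y⟩ hz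
    rw [Set.mem_compl_iff, Set.mem_prod, not_and_or] at hz
    rcases hz with hx | hy
    · simp only [hzero x hx, zero_sub, abs_neg]
      by_cases hy : f y = 0
      · simp [hy, Real.zero_rpow hp0.ne']
      · refine le_add_left (le_of_eq ?_)
        simp only [a, h]
        rw [Set.indicator_of_mem (show x - y ∈ {x | δ / 2 ≤ ‖x‖} from hfar x hx y hy)]
    · simp only [hzero y hy, sub_zero]
      by_cases hx : f x = 0
      · simp [hx, Real.zero_rpow hp0.ne']
      · refine le_add_right (le_of_eq ?_)
        have hd := hfar y hy x hx
        rw [norm_sub_rev] at hd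
        simp only [a, h]
        rw [Set.indicator_of_mem (show x - y ∈ {x | δ / 2 ≤ ‖x‖} from hd)]
  refine (setLIntegral_mono' (Metric.isOpen_ball.measurableSet.prod
    Metric.isOpen_ball.measurableSet).compl hbound).trans
    ((setLIntegral_le_lintegral _ _).trans (le_of_eq ?_))
  rw [lintegral_add_left (by fun_prop), lintegral_mul_comp_sub ham hhm,
    lintegral_mul_comp_sub' ham hhm, ENNReal.ofReal_mul (by norm_num),
    ENNReal.ofReal_toReal hhi.ne, ENNReal.ofReal_ofNat]
  ring

end Estimates

section FracGrad

variable {n : ℕ} {s p : ℝ}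

theorem fracGrad_add (u v : EuclideanSpace ℝ (Fin n) → ℝ) :
    fracGrad s (u + v) = fracGrad s u + fracGrad s v := by
  ext z
  simp only [fracGrad, Pi.add_apply]
  ring

theorem fracGrad_sub (u v : EuclideanSpace ℝ (Fin n) → ℝ) :
    fracGrad s (u - v) = fracGrad s u - fracGrad s v := by
  ext z
  simp only [fracGrad, Pi.sub_apply]
  ring

theorem fracGrad_const_smul (c : ℝ) (u : EuclideanSpace ℝ (Fin n) → ℝ) :
    fracGrad s (c • u) = c • fracGrad s u := by
  ext z
  simp only [fracGrad, Pi.smul_apply, smul_eq_mul]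
  ring

theorem aestronglyMeasurable_fracGrad {u : EuclideanSpace ℝ (Fin n) → ℝ}
    (hu : AEStronglyMeasurable u volume) :
    AEStronglyMeasurable (fracGrad s u) (offDiagMeasure n) := by
  refine AEStronglyMeasurable.mono_ac (withDensity_absolutelyContinuous _ _) ?_
  have h1 : AEStronglyMeasurable
      (fun z : EuclideanSpace ℝ (Fin n) × EuclideanSpace ℝ (Fin n) => u z.1 - u z.2)
      (volume.prod volume) := hu.comp_fst.sub hu.comp_snd
  have h2 : Measurable fun z : EuclideanSpace ℝ (Fin n) × EuclideanSpace ℝ (Fin n) =>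
      (‖z.1 - z.2‖ ^ s)⁻¹ := by fun_prop
  exact h1.mul h2.aestronglyMeasurable

theorem memLp_fracGrad {u : EuclideanSpace ℝ (Fin n) → ℝ} (hu : u ∈ SobolevSpace n s p) :
    MemLp (fracGrad s u) (ENNReal.ofReal p) (offDiagMeasure n) :=
  ⟨aestronglyMeasurable_fracGrad hu.1.1, hu.2⟩

theorem SobolevSpace.add {u v : EuclideanSpace ℝ (Fin n) → ℝ} (hu : u ∈ SobolevSpace n s p)
    (hv : v ∈ SobolevSpace n s p) : u + v ∈ SobolevSpace n s p := by
  refine ⟨hu.1.add hv.1, ?_⟩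
  rw [gagliardo, fracGrad_add]
  exact ((memLp_fracGrad hu).add (memLp_fracGrad hv)).2

theorem SobolevSpace.sub {u v : EuclideanSpace ℝ (Fin n) → ℝ} (hu : u ∈ SobolevSpace n s p)
    (hv : v ∈ SobolevSpace n s p) : u - v ∈ SobolevSpace n s p := by
  refine ⟨hu.1.sub hv.1, ?_⟩
  rw [gagliardo, fracGrad_sub]
  exact ((memLp_fracGrad hu).sub (memLp_fracGrad hv)).2

theorem sobolevNorm_rpow (hp : 1 < p) (u : EuclideanSpace ℝ (Fin n) → ℝ) :
    sobolevNorm s p u ^ p =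
      eLpNorm u (ENNReal.ofReal p) volume ^ p + gagliardo s p u ^ p := by
  rw [sobolevNorm, ← ENNReal.rpow_mul, one_div, inv_mul_cancel₀ (by linarith), ENNReal.rpow_one]

theorem sobolevNorm_const_smul (hp : 1 < p) (c : ℝ) (u : EuclideanSpace ℝ (Fin n) → ℝ) :
    sobolevNorm s p (c • u) = ‖c‖ₑ * sobolevNorm s p u := by
  have hp0 : 0 < p := by linarith
  rw [sobolevNorm, sobolevNorm, gagliardo, gagliardo, fracGrad_const_smul, eLpNorm_const_smul,
    eLpNorm_const_smul, ENNReal.mul_rpow_of_nonneg _ _ hp0.le, ENNReal.mul_rpow_of_nonneg _ _ hp0.le,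
    ← mul_add, ENNReal.mul_rpow_of_nonneg _ _ (by positivity), ← ENNReal.rpow_mul, mul_one_div_cancel hp0.ne',
    ENNReal.rpow_one]

theorem mem_sobolevTilde_iff (hp : 1 < p) {U : Set (EuclideanSpace ℝ (Fin n))}
    {u : EuclideanSpace ℝ (Fin n) → ℝ} :
    u ∈ SobolevTilde s p U ↔ u ∈ SobolevSpace n s p ∧ ∀ ε : ℝ, 0 < ε → ∃ φ ∈ TestFun U,
      eLpNorm (u - φ) (ENNReal.ofReal p) volume ^ p + gagliardo s p (u - φ) ^ p ≤
        ENNReal.ofReal ε := by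
  have hp0 : 0 < p := by linarith
  refine and_congr_right fun _ => ⟨fun h ε hε => ?_, fun h ε hε => ?_⟩
  · obtain ⟨φ, hφ, hlt⟩ := h (ENNReal.ofReal ε ^ p⁻¹)
      (ENNReal.rpow_pos (ENNReal.ofReal_pos.2 hε) ENNReal.ofReal_ne_top)
    refine ⟨φ, hφ, ?_⟩
    rw [← sobolevNorm_rpow hp]
    exact ((ENNReal.lt_rpow_inv_iff hp0).1 hlt).le
  · obtain ⟨e, he0, he⟩ := ENNReal.lt_iff_exists_nnreal_btwn.1
      (show 0 < ε ^ p from ENNReal.rpow_pos_of_nonneg hε hp0.le)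
    obtain ⟨φ, hφ, hle⟩ := h e (by exact_mod_cast he0)
    refine ⟨φ, hφ, ?_⟩
    rw [← sobolevNorm_rpow hp, ENNReal.ofReal_coe_nnreal] at hle
    exact (ENNReal.rpow_lt_rpow_iff hp0).1 (hle.trans_lt he)

theorem TestFun.mem_sobolevTilde (hn : 1 ≤ n) (hs0 : 0 < s) (hs1 : s < 1) (hp : 1 < p)
    {U : Set (EuclideanSpace ℝ (Fin n))} {φ : EuclideanSpace ℝ (Fin n) → ℝ}
    (hφ : φ ∈ TestFun U) : φ ∈ SobolevTilde s p U := by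
  have hp0 : 0 < p := by linarith
  refine (mem_sobolevTilde_iff hp).2 ⟨TestFun.mem_sobolevSpace hn hs0 hs1 hp hφ,
    fun ε hε => ⟨φ, hφ, ?_⟩⟩
  have h0 : fracGrad s (0 : EuclideanSpace ℝ (Fin n) → ℝ) = 0 := by
    ext z
    simp [fracGrad]
  simp [gagliardo, h0, hp0]

/-- Elements of `W̃^{s,p}(U)` vanish almost everywhere outside `U`. -/
theorem SobolevTilde.ae_eq_zero (hp : 1 < p) {U : Set (EuclideanSpace ℝ (Fin n))}
    {v : EuclideanSpace ℝ (Fin n) → ℝ} (hU : MeasurableSet U) (hv : v ∈ SobolevTilde s p U) :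
    ∀ᵐ x, x ∉ U → v x = 0 := by
  have hp0 : 0 < p := by linarith
  obtain ⟨hvS, happ⟩ := (mem_sobolevTilde_iff hp).1 hv
  have h0 : ∫⁻ x in Uᶜ, ENNReal.ofReal (|v x| ^ p) = 0 := by
    refine le_antisymm (ENNReal.le_of_forall_pos_le_add fun ε hε _ => ?_) zero_le
    obtain ⟨φ, hφ, hle⟩ := happ ε hε
    rw [ENNReal.ofReal_coe_nnreal, eLpNorm_rpow_eq_lintegral hp] at hle
    rw [zero_add]
    refine le_trans ?_ ((le_add_right le_rfl).trans hle)
    refine le_trans ?_ (setLIntegral_le_lintegral Uᶜ _)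
    refine setLIntegral_mono' hU.compl fun x hx => ?_
    rw [Pi.sub_apply, TestFun.eq_zero hφ hx, sub_zero]
  rw [lintegral_eq_zero_iff' (by
    have := hvS.1.1.aemeasurable
    exact (((this.norm.pow_const p).ennreal_ofReal)).restrict),
    Filter.EventuallyEq, ae_restrict_iff' hU.compl] at h0
  filter_upwards [h0] with x hx hxU
  have h1 := hx hxU
  rw [Pi.zero_apply, ENNReal.ofReal_eq_zero] at h1
  by_contra hne
  have : 0 < |v x| ^ p := Real.rpow_pos_of_pos (abs_pos.2 hne) p
  linarith

end FracGrad

section EnergyMeasure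

variable {n : ℕ} {s p : ℝ}
  {σ : EuclideanSpace ℝ (Fin n) → EuclideanSpace ℝ (Fin n) → ℝ} {c : ℝ}

/-- The measure `σ dμ`, with `μ = dx dy / |x - y|ⁿ`. -/
noncomputable def energyMeasure (σ : EuclideanSpace ℝ (Fin n) → EuclideanSpace ℝ (Fin n) → ℝ) :
    Measure (EuclideanSpace ℝ (Fin n) × EuclideanSpace ℝ (Fin n)) :=
  (offDiagMeasure n).withDensity fun z => ENNReal.ofReal (σ z.1 z.2)

/-- Measurability and uniform ellipticity of a coefficient. -/
structure IsElliptic (σ : EuclideanSpace ℝ (Fin n) → EuclideanSpace ℝ (Fin n) → ℝ) (c : ℝ) :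
    Prop where
  aemeasurable : AEMeasurable
    (fun z : EuclideanSpace ℝ (Fin n) × EuclideanSpace ℝ (Fin n) => σ z.1 z.2) volume
  pos : 0 < c
  le : ∀ x y, c ≤ σ x y
  le_inv : ∀ x y, σ x y ≤ c⁻¹

theorem Admissible.exists_isElliptic {W : Set (EuclideanSpace ℝ (Fin n))}
    (h : Admissible W σ) : ∃ c, IsElliptic σ c := by
  obtain ⟨c, hc, hb⟩ := h.elliptic
  exact ⟨c, h.measurable, hc, fun x y => (hb x y).1, fun x y => (hb x y).2⟩

namespace IsElliptic

theorem aemeasurable_ofReal (h : IsElliptic σ c) : AEMeasurable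
    (fun z : EuclideanSpace ℝ (Fin n) × EuclideanSpace ℝ (Fin n) => ENNReal.ofReal (σ z.1 z.2))
    (offDiagMeasure n) :=
  (h.aemeasurable.mono_ac (withDensity_absolutelyContinuous _ _)).ennreal_ofReal

theorem setLIntegral_energyMeasure (h : IsElliptic σ c)
    {S : Set (EuclideanSpace ℝ (Fin n) × EuclideanSpace ℝ (Fin n))} (hS : MeasurableSet S)
    (g : EuclideanSpace ℝ (Fin n) × EuclideanSpace ℝ (Fin n) → ℝ≥0∞) :
    ∫⁻ z in S, g z ∂(energyMeasure σ) =
      ∫⁻ z in S, ENNReal.ofReal (σ z.1 z.2) * g z ∂(offDiagMeasure n) := by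
  rw [energyMeasure, restrict_withDensity hS,
    lintegral_withDensity_eq_lintegral_mul_non_measurable₀ _ h.aemeasurable_ofReal.restrict
      (Eventually.of_forall fun _ => ENNReal.ofReal_lt_top)]
  rfl

theorem le_setLIntegral_energyMeasure (h : IsElliptic σ c) {r : ℝ}
    {S : Set (EuclideanSpace ℝ (Fin n) × EuclideanSpace ℝ (Fin n))} (hS : MeasurableSet S)
    (hr : ∀ z ∈ S, r ≤ σ z.1 z.2)
    (g : EuclideanSpace ℝ (Fin n) × EuclideanSpace ℝ (Fin n) → ℝ≥0∞) :
    ENNReal.ofReal r * ∫⁻ z in S, g z ∂(offDiagMeasure n) ≤ ∫⁻ z in S, g z ∂(energyMeasure σ) := by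
  rw [h.setLIntegral_energyMeasure hS, ← lintegral_const_mul' _ _ ENNReal.ofReal_ne_top]
  refine setLIntegral_mono' hS fun z hz => ?_
  gcongr
  exact hr z hz

theorem setLIntegral_energyMeasure_le (h : IsElliptic σ c) {r : ℝ}
    {S : Set (EuclideanSpace ℝ (Fin n) × EuclideanSpace ℝ (Fin n))} (hS : MeasurableSet S)
    (hr : ∀ z ∈ S, σ z.1 z.2 ≤ r)
    (g : EuclideanSpace ℝ (Fin n) × EuclideanSpace ℝ (Fin n) → ℝ≥0∞) :
    ∫⁻ z in S, g z ∂(energyMeasure σ) ≤ ENNReal.ofReal r * ∫⁻ z in S, g z ∂(offDiagMeasure n) := by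
  rw [h.setLIntegral_energyMeasure hS, ← lintegral_const_mul' _ _ ENNReal.ofReal_ne_top]
  refine setLIntegral_mono' hS fun z hz => ?_
  gcongr
  exact hr z hz

theorem eLpNorm_energyMeasure_le (h : IsElliptic σ c) (hp : 1 < p)
    (A : EuclideanSpace ℝ (Fin n) × EuclideanSpace ℝ (Fin n) → ℝ) :
    eLpNorm A (ENNReal.ofReal p) (energyMeasure σ) ^ p ≤
      ENNReal.ofReal c⁻¹ * eLpNorm A (ENNReal.ofReal p) (offDiagMeasure n) ^ p := by
  simpa [eLpNorm_rpow_eq_lintegral hp] using h.setLIntegral_energyMeasure_le MeasurableSet.univ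
    (fun z _ => h.le_inv z.1 z.2) fun z => ENNReal.ofReal (|A z| ^ p)

theorem le_eLpNorm_energyMeasure (h : IsElliptic σ c) (hp : 1 < p)
    (A : EuclideanSpace ℝ (Fin n) × EuclideanSpace ℝ (Fin n) → ℝ) :
    eLpNorm A (ENNReal.ofReal p) (offDiagMeasure n) ^ p ≤
      ENNReal.ofReal c⁻¹ * eLpNorm A (ENNReal.ofReal p) (energyMeasure σ) ^ p := by
  have h1 : ENNReal.ofReal c * eLpNorm A (ENNReal.ofReal p) (offDiagMeasure n) ^ p ≤
      eLpNorm A (ENNReal.ofReal p) (energyMeasure σ) ^ p := by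
    simpa [eLpNorm_rpow_eq_lintegral hp] using h.le_setLIntegral_energyMeasure MeasurableSet.univ
      (fun z _ => h.le z.1 z.2) fun z => ENNReal.ofReal (|A z| ^ p)
  calc _ = ENNReal.ofReal c⁻¹ *
        (ENNReal.ofReal c * eLpNorm A (ENNReal.ofReal p) (offDiagMeasure n) ^ p) := by
        rw [← mul_assoc, ← ENNReal.ofReal_mul (inv_pos.2 h.pos).le, inv_mul_cancel₀ h.pos.ne',
          ENNReal.ofReal_one, one_mul]
    _ ≤ _ := by gcongr

theorem memLp_fracGrad (h : IsElliptic σ c) (hp : 1 < p) {u : EuclideanSpace ℝ (Fin n) → ℝ}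
    (hu : u ∈ SobolevSpace n s p) :
    MemLp (fracGrad s u) (ENNReal.ofReal p) (energyMeasure σ) := by
  have hp0 : 0 < p := by linarith
  refine ⟨(aestronglyMeasurable_fracGrad hu.1.1).mono_ac (withDensity_absolutelyContinuous _ _), ?_⟩
  have h1 := (h.eLpNorm_energyMeasure_le hp (fracGrad s u)).trans_lt
    (ENNReal.mul_lt_top ENNReal.ofReal_lt_top (ENNReal.rpow_lt_top_of_nonneg hp0.le hu.2.ne))
  by_contra htop
  rw [not_lt_top_iff] at htop
  simp [htop, hp0] at h1

theorem weakForm_eq (h : IsElliptic σ c) (u φ : EuclideanSpace ℝ (Fin n) → ℝ) :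
    weakForm s p σ u φ =
      ∫ z, |fracGrad s u z| ^ (p - 2) * fracGrad s u z * fracGrad s φ z ∂(energyMeasure σ) := by
  rw [weakForm, energyMeasure, integral_withDensity_eq_integral_toReal_smul₀ h.aemeasurable_ofReal
    (Eventually.of_forall fun _ => ENNReal.ofReal_lt_top)]
  congr 1
  ext z
  rw [ENNReal.toReal_ofReal (h.pos.le.trans (h.le _ _)), smul_eq_mul]
  ring

end IsElliptic

end EnergyMeasure

theorem tendsto_zero_of_rpow_le {p : ℝ} (hp : 0 < p) {x : ℕ → ℝ≥0∞}
    (h : ∀ ε : ℝ, 0 < ε → ∃ N, ∀ k, N ≤ k → x k ^ p ≤ ENNReal.ofReal ε) :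
    Tendsto x atTop (𝓝 0) := by
  rw [ENNReal.tendsto_nhds_zero]
  intro ε hε
  obtain ⟨e, he0, he⟩ := ENNReal.lt_iff_exists_nnreal_btwn.1
    (show 0 < ε ^ p from ENNReal.rpow_pos_of_nonneg hε hp.le)
  obtain ⟨N, hN⟩ := h e (by exact_mod_cast he0)
  refine eventually_atTop.2 ⟨N, fun k hk => ?_⟩
  have := hN k hk
  rw [ENNReal.ofReal_coe_nnreal] at this
  exact (ENNReal.rpow_le_rpow_iff hp).1 (this.trans he.le)

section Completeness

variable {n : ℕ} {s p : ℝ}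

/-- A sequence that is Cauchy in `W^{s,p}(ℝⁿ)` converges. -/
theorem exists_sobolev_limit (hp : 1 < p) {φ : ℕ → EuclideanSpace ℝ (Fin n) → ℝ}
    (hφ : ∀ k, φ k ∈ SobolevSpace n s p)
    (hL : ∀ ε : ℝ, 0 < ε → ∃ N, ∀ j k, N ≤ j → N ≤ k →
      eLpNorm (φ j - φ k) (ENNReal.ofReal p) volume ^ p ≤ ENNReal.ofReal ε)
    (hG : ∀ ε : ℝ, 0 < ε → ∃ N, ∀ j k, N ≤ j → N ≤ k →
      gagliardo s p (φ j - φ k) ^ p ≤ ENNReal.ofReal ε) :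
    ∃ v ∈ SobolevSpace n s p,
      Tendsto (fun k => eLpNorm (φ k - v) (ENNReal.ofReal p) volume) atTop (𝓝 0) ∧
      Tendsto (fun k => gagliardo s p (φ k - v)) atTop (𝓝 0) := by
  have hp0 : 0 < p := by linarith
  have : Fact (1 ≤ ENNReal.ofReal p) := ⟨by simpa using hp.le⟩
  have hcau : CauchySeq fun k => (hφ k).1.toLp (φ k) := by
    rw [EMetric.cauchySeq_iff]
    intro ε hε
    obtain ⟨e, he0, he⟩ := ENNReal.lt_iff_exists_nnreal_btwn.1
      (show 0 < ε ^ p from ENNReal.rpow_pos_of_nonneg hε hp0.le)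
    obtain ⟨N, hN⟩ := hL e (by exact_mod_cast he0)
    refine ⟨N, fun j hj k hk => ?_⟩
    rw [Lp.edist_toLp_toLp]
    have := hN j k hj hk
    rw [ENNReal.ofReal_coe_nnreal] at this
    exact (ENNReal.rpow_lt_rpow_iff hp0).1 (this.trans_lt he)
  obtain ⟨G, hGlim⟩ := cauchySeq_tendsto_of_complete hcau
  have hvL : MemLp (G : EuclideanSpace ℝ (Fin n) → ℝ) (ENNReal.ofReal p) volume := Lp.memLp G
  rw [← Lp.toLp_coeFn G hvL, Lp.tendsto_Lp_iff_tendsto_eLpNorm''] at hGlim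
  set v : EuclideanSpace ℝ (Fin n) → ℝ := ⇑G with hv
  obtain ⟨ns, hns, hae⟩ := (tendstoInMeasure_of_tendsto_eLpNorm (by simpa using hp0)
    (fun k => (hφ k).1.1) hvL.1 hGlim).exists_seq_tendsto_ae
  have hae2 : ∀ᵐ z ∂(offDiagMeasure n), ∀ j, Tendsto
      (fun i => fracGrad s (φ j - φ (ns i)) z) atTop (𝓝 (fracGrad s (φ j - v) z)) := by
    have h1 : ∀ᵐ z : EuclideanSpace ℝ (Fin n) × EuclideanSpace ℝ (Fin n),
        Tendsto (fun i => φ (ns i) z.1) atTop (𝓝 (v z.1)) :=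
      Measure.quasiMeasurePreserving_fst.ae hae
    have h2 : ∀ᵐ z : EuclideanSpace ℝ (Fin n) × EuclideanSpace ℝ (Fin n),
        Tendsto (fun i => φ (ns i) z.2) atTop (𝓝 (v z.2)) :=
      Measure.quasiMeasurePreserving_snd.ae hae
    filter_upwards [(withDensity_absolutelyContinuous _ _).ae_le h1,
      (withDensity_absolutelyContinuous _ _).ae_le h2] with z h1 h2 j
    simp only [fracGrad, Pi.sub_apply]
    exact ((h1.const_sub _).sub (h2.const_sub _)).div_const _
  have hlim : ∀ ε : ℝ, 0 < ε → ∃ N, ∀ k, N ≤ k →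
      gagliardo s p (φ k - v) ^ p ≤ ENNReal.ofReal ε := by
    intro ε hε
    obtain ⟨N, hN⟩ := hG ε hε
    refine ⟨N, fun k hk => ?_⟩
    rw [← ENNReal.le_rpow_inv_iff hp0]
    refine (Lp.eLpNorm_lim_le_liminf_eLpNorm
      (fun i => aestronglyMeasurable_fracGrad ((hφ k).1.1.sub (hφ (ns i)).1.1)) _
      (hae2.mono fun z hz => hz k)).trans ?_
    refine liminf_le_of_frequently_le' (Eventually.frequently ?_)
    filter_upwards [hns.tendsto_atTop.eventually_ge_atTop N] with i hi
    rw [ENNReal.le_rpow_inv_iff hp0]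
    exact hN k (ns i) hk hi
  have hmem : v ∈ SobolevSpace n s p := by
    obtain ⟨N, hN⟩ := hlim 1 one_pos
    have h1 : φ N - v ∈ SobolevSpace n s p := by
      refine ⟨(hφ N).1.sub hvL, ?_⟩
      have h2 := (hN N le_rfl).trans_lt ENNReal.ofReal_lt_top
      by_contra htop
      rw [not_lt_top_iff] at htop
      simp [htop, hp0] at h2
    have h3 := SobolevSpace.sub (hφ N) h1
    rwa [sub_sub_cancel] at h3
  exact ⟨v, hmem, hGlim, tendsto_zero_of_rpow_le hp0 hlim⟩

end Completeness

section Existence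

variable {n : ℕ} {s p : ℝ} {Ω : Set (EuclideanSpace ℝ (Fin n))}
  {σ : EuclideanSpace ℝ (Fin n) → EuclideanSpace ℝ (Fin n) → ℝ} {c : ℝ}

theorem exists_isWeakSolution (hn : 1 ≤ n) (hs0 : 0 < s) (hs1 : s < 1) (hp : 1 < p)
    (hΩb : Bornology.IsBounded Ω) (hσ : IsElliptic σ c) {f : EuclideanSpace ℝ (Fin n) → ℝ}
    (hf : f ∈ SobolevSpace n s p) : ∃ u, IsWeakSolution s p Ω σ f u := by
  have hp0 : 0 < p := by linarith
  have hTS : ∀ φ ∈ TestFun Ω, φ ∈ SobolevSpace n s p := fun φ hφ =>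
    TestFun.mem_sobolevSpace hn hs0 hs1 hp hφ
  let J : (EuclideanSpace ℝ (Fin n) → ℝ) → ℝ := fun φ =>
    ∫ z, |fracGrad s (f + φ) z| ^ p ∂(energyMeasure σ)
  have hbdd : BddBelow (J '' TestFun Ω) := by
    refine ⟨0, ?_⟩
    rintro _ ⟨φ, -, rfl⟩
    exact integral_nonneg fun z => by positivity
  obtain ⟨S, -, hSlim, hSmem⟩ := exists_seq_tendsto_sInf
    (Set.Nonempty.image J ⟨0, TestFun.zero_mem⟩) hbdd
  choose φ hφ hφS using hSmem
  set I := sInf (J '' TestFun Ω) with hI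
  have hIle : ∀ ψ ∈ TestFun Ω, I ≤ J ψ := fun ψ hψ => csInf_le hbdd ⟨ψ, hψ, rfl⟩
  have hmemf : ∀ ψ ∈ TestFun Ω, MemLp (fracGrad s (f + ψ)) (ENNReal.ofReal p) (energyMeasure σ) :=
    fun ψ hψ => hσ.memLp_fracGrad hp (SobolevSpace.add hf (hTS ψ hψ))
  have hJlim : Tendsto (fun k => ∫ z, |fracGrad s (f + φ k) z| ^ p ∂(energyMeasure σ)) atTop
      (𝓝 I) := by
    refine hSlim.congr fun k => ?_
    rw [← hφS k]
  have hcau := fun (ε : ℝ) (hε : 0 < ε) => exists_forall_integral_rpow_sub_le (ε := ε) hp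
    (fun k => hmemf (φ k) (hφ k)) hJlim (fun j k => by
      have h1 := hIle ((1 / 2 : ℝ) • (φ j + φ k))
        (TestFun.const_smul (TestFun.add (hφ j) (hφ k)) _)
      refine h1.trans_eq ?_
      simp only [J]
      congr 1
      ext z
      congr 2
      simp only [fracGrad_add, fracGrad_const_smul, Pi.add_apply, Pi.smul_apply, smul_eq_mul]
      ring) hε
  have hG : ∀ ε : ℝ, 0 < ε → ∃ N, ∀ j k, N ≤ j → N ≤ k →
      gagliardo s p (φ j - φ k) ^ p ≤ ENNReal.ofReal ε := by
    intro ε hε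
    obtain ⟨N, hN⟩ := hcau (c * ε) (mul_pos hσ.pos hε)
    refine ⟨N, fun j k hj hk => ?_⟩
    refine (hσ.le_eLpNorm_energyMeasure hp _).trans ?_
    rw [← ofReal_integral_abs_rpow hp (hσ.memLp_fracGrad hp
      (SobolevSpace.sub (hTS _ (hφ j)) (hTS _ (hφ k)))),
      ← ENNReal.ofReal_mul (inv_pos.2 hσ.pos).le]
    refine ENNReal.ofReal_le_ofReal ?_
    rw [inv_mul_le_iff₀ hσ.pos]
    refine (le_of_eq ?_).trans (hN j k hj hk)
    congr 1
    ext z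
    congr 2
    simp only [fracGrad_add, fracGrad_sub, Pi.add_apply, Pi.sub_apply]
    ring
  obtain ⟨C, hC, hpoin⟩ := exists_poincare hn s hp
  obtain ⟨R, hR, hΩR⟩ := hΩb.subset_ball_lt 0 0
  have hL : ∀ ε : ℝ, 0 < ε → ∃ N, ∀ j k, N ≤ j → N ≤ k →
      eLpNorm (φ j - φ k) (ENNReal.ofReal p) volume ^ p ≤ ENNReal.ofReal ε := by
    intro ε hε
    have hD : 0 < C * R ^ (s * p) := by positivity
    obtain ⟨N, hN⟩ := hG ((C * R ^ (s * p))⁻¹ * ε) (by positivity)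
    refine ⟨N, fun j k hj hk => ?_⟩
    have hT := TestFun.sub (hφ j) (hφ k)
    refine (hpoin 0 R hR _ hT.1.continuous.measurable
      (fun x hx => TestFun.eq_zero hT fun h => hx (hΩR h)) hs0.le).trans ?_
    refine (mul_le_mul_right (hN j k hj hk) _).trans ?_
    rw [← ENNReal.ofReal_mul hD.le, mul_inv_cancel_left₀ hD.ne']
  obtain ⟨v, hvS, hvL, hvG⟩ := exists_sobolev_limit hp (fun k => hTS _ (hφ k)) hL hG
  have hvT : v ∈ SobolevTilde s p Ω := by
    refine (mem_sobolevTilde_iff hp).2 ⟨hvS, fun ε hε => ?_⟩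
    have hsum : Tendsto (fun k => eLpNorm (φ k - v) (ENNReal.ofReal p) volume ^ p +
        gagliardo s p (φ k - v) ^ p) atTop (𝓝 0) := by
      have h1 := ((ENNReal.continuous_rpow_const (y := p)).tendsto 0).comp hvL
      have h2 := ((ENNReal.continuous_rpow_const (y := p)).tendsto 0).comp hvG
      have h3 := h1.add h2
      simpa [ENNReal.zero_rpow_of_pos hp0] using h3
    obtain ⟨k, hk⟩ := (hsum.eventually_le_const (ENNReal.ofReal_pos.2 hε)).exists
    refine ⟨φ k, hφ k, ?_⟩
    rw [gagliardo, fracGrad_sub, eLpNorm_sub_comm, eLpNorm_sub_comm (fracGrad s v)]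
    rwa [gagliardo, fracGrad_sub] at hk
  have huS := SobolevSpace.add hf hvS
  have hA := hσ.memLp_fracGrad hp huS
  have hlimσ : Tendsto (fun k => eLpNorm (fracGrad s (φ k - v)) (ENNReal.ofReal p)
      (energyMeasure σ)) atTop (𝓝 0) := by
    refine tendsto_zero_of_rpow_le hp0 fun ε hε => ?_
    have h2 := ((ENNReal.continuous_rpow_const (y := p)).tendsto 0).comp hvG
    rw [ENNReal.zero_rpow_of_pos hp0] at h2
    obtain ⟨N, hN⟩ := eventually_atTop.1 (h2.eventually_le_const
      (ENNReal.ofReal_pos.2 (mul_pos hσ.pos hε)))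
    refine ⟨N, fun k hk => (hσ.eLpNorm_energyMeasure_le hp _).trans ?_⟩
    refine (mul_le_mul_right (hN k hk) _).trans ?_
    rw [← ENNReal.ofReal_mul (inv_pos.2 hσ.pos).le, inv_mul_cancel_left₀ hσ.pos.ne']
  have hlimψ : ∀ ψ ∈ TestFun Ω, Tendsto
      (fun k => ∫ z, |fracGrad s (f + (φ k + ψ)) z| ^ p ∂(energyMeasure σ)) atTop
      (𝓝 (∫ z, |fracGrad s (f + v + ψ) z| ^ p ∂(energyMeasure σ))) := by
    intro ψ hψ
    refine tendsto_integral_rpow_of_tendsto_eLpNorm hp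
      (fun k => hmemf _ (TestFun.add (hφ k) hψ))
      (hσ.memLp_fracGrad hp (SobolevSpace.add huS (hTS ψ hψ))) (hlimσ.congr fun k => ?_)
    rw [← fracGrad_sub]
    congr 2
    abel
  have hJu : ∫ z, |fracGrad s (f + v) z| ^ p ∂(energyMeasure σ) = I := by
    have h1 := hlimψ 0 TestFun.zero_mem
    simp only [add_zero] at h1
    exact tendsto_nhds_unique h1 hJlim
  have hnonneg : ∀ ψ ∈ TestFun Ω, 0 ≤ weakForm s p σ (f + v) ψ := by
    intro ψ hψ
    rw [hσ.weakForm_eq]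
    refine integral_rpow_mul_nonneg_of_min hp hA (hσ.memLp_fracGrad hp (hTS ψ hψ)) fun t => ?_
    have h1 : I ≤ ∫ z, |fracGrad s (f + v + t • ψ) z| ^ p ∂(energyMeasure σ) :=
      ge_of_tendsto' (hlimψ _ (TestFun.const_smul hψ t)) fun k =>
        hIle _ (TestFun.add (hφ k) (TestFun.const_smul hψ t))
    rw [hJu]
    rwa [fracGrad_add, fracGrad_const_smul] at h1
  refine ⟨f + v, huS, fun ψ hψ => le_antisymm ?_ (hnonneg ψ hψ), by rwa [add_sub_cancel_left]⟩
  have h1 := hnonneg _ (TestFun.const_smul hψ (-1))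
  have h2 : weakForm s p σ (f + v) ((-1 : ℝ) • ψ) = -weakForm s p σ (f + v) ψ := by
    rw [weakForm, weakForm, ← integral_neg, fracGrad_const_smul]
    congr 1
    ext z
    simp
  linarith

end Existence

section Solution

variable {n : ℕ} {s p : ℝ} {Ω : Set (EuclideanSpace ℝ (Fin n))}
  {σ : EuclideanSpace ℝ (Fin n) → EuclideanSpace ℝ (Fin n) → ℝ} {c : ℝ}
  {f u : EuclideanSpace ℝ (Fin n) → ℝ}

theorem IsWeakSolution.weakForm_eq_zero (hn : 1 ≤ n) (hs0 : 0 < s) (hs1 : s < 1) (hp : 1 < p)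
    (hσ : IsElliptic σ c) (hu : IsWeakSolution s p Ω σ f u)
    {v : EuclideanSpace ℝ (Fin n) → ℝ} (hv : v ∈ SobolevTilde s p Ω) :
    weakForm s p σ u v = 0 := by
  obtain ⟨hvS, happ⟩ := (mem_sobolevTilde_iff hp).1 hv
  rw [hσ.weakForm_eq]
  refine integral_rpow_mul_eq_zero_of_approx hp (hσ.memLp_fracGrad hp hu.mem)
    (hσ.memLp_fracGrad hp hvS) fun ε hε => ?_
  obtain ⟨φ, hφ, hle⟩ := happ (c * ε) (mul_pos hσ.pos hε)
  have hφS := TestFun.mem_sobolevSpace hn hs0 hs1 hp hφ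
  refine ⟨fracGrad s φ, hσ.memLp_fracGrad hp hφS, ?_, ?_⟩
  · rw [← hσ.weakForm_eq]
    exact hu.weak φ hφ
  · rw [← ENNReal.ofReal_le_ofReal_iff hε.le]
    have hm := hσ.memLp_fracGrad hp (SobolevSpace.sub hvS hφS)
    have h1 := ofReal_integral_abs_rpow hp hm
    simp only [fracGrad_sub, Pi.sub_apply] at h1
    rw [h1, ← fracGrad_sub]
    refine (hσ.eLpNorm_energyMeasure_le hp _).trans ?_
    refine (mul_le_mul_right ((le_add_left le_rfl).trans hle) _).trans ?_
    rw [← ENNReal.ofReal_mul (inv_pos.2 hσ.pos).le, inv_mul_cancel_left₀ hσ.pos.ne']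

theorem IsWeakSolution.weakForm_self (hn : 1 ≤ n) (hs0 : 0 < s) (hs1 : s < 1) (hp : 1 < p)
    (hσ : IsElliptic σ c) (hf : f ∈ SobolevSpace n s p) (hu : IsWeakSolution s p Ω σ f u) :
    weakForm s p σ u f = ∫ z, |fracGrad s u z| ^ p ∂(energyMeasure σ) := by
  have h1 := hu.weakForm_eq_zero hn hs0 hs1 hp hσ hu.exterior
  have hA := hσ.memLp_fracGrad hp hu.mem
  have hB := hσ.memLp_fracGrad hp hf
  rw [hσ.weakForm_eq, fracGrad_sub] at h1
  rw [hσ.weakForm_eq, ← integral_rpow_mul_self hp]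
  have h2 := integral_sub (integrable_rpow_mul hp hA hA) (integrable_rpow_mul hp hA hB)
  simp only [← mul_sub] at h2
  simp only [Pi.sub_apply] at h1
  linarith

/-- The energy of a solution is at most the energy of its exterior datum. -/
theorem IsWeakSolution.energy_le (hn : 1 ≤ n) (hs0 : 0 < s) (hs1 : s < 1) (hp : 1 < p)
    (hσ : IsElliptic σ c) (hf : f ∈ SobolevSpace n s p) (hu : IsWeakSolution s p Ω σ f u) :
    ∫ z, |fracGrad s u z| ^ p ∂(energyMeasure σ) ≤
      ∫ z, |fracGrad s f z| ^ p ∂(energyMeasure σ) := by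
  have hp0 : 0 < p := by linarith
  have h1 := hu.weakForm_self hn hs0 hs1 hp hσ hf
  have h2 := le_of_abs_le (abs_integral_rpow_mul_le hp (hσ.memLp_fracGrad hp hu.mem)
    (hσ.memLp_fracGrad hp hf))
  rw [← hσ.weakForm_eq, h1] at h2
  have h3 : 0 < 1 / p := by positivity
  have h4 : 1 / p * ∫ z, |fracGrad s u z| ^ p ∂(energyMeasure σ) ≤
      1 / p * ∫ z, |fracGrad s f z| ^ p ∂(energyMeasure σ) := by linarith
  exact le_of_mul_le_mul_left h4 h3

/-- Away from `Ω` the energy densities of a solution and of its exterior datum agree. -/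
theorem IsWeakSolution.setLIntegral_le_energy (hp : 1 < p) (hΩ : IsOpen Ω)
    (hσ : IsElliptic σ c) (hu : IsWeakSolution s p Ω σ f u)
    {B : Set (EuclideanSpace ℝ (Fin n))} (hB : MeasurableSet B) (hBΩ : Disjoint B Ω) :
    ∫⁻ z in B ×ˢ B, ENNReal.ofReal (|fracGrad s f z| ^ p) ∂(energyMeasure σ) ≤
      ENNReal.ofReal (∫ z, |fracGrad s u z| ^ p ∂(energyMeasure σ)) := by
  rw [ofReal_integral_abs_rpow hp (hσ.memLp_fracGrad hp hu.mem), eLpNorm_rpow_eq_lintegral hp]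
  refine le_trans (le_of_eq ?_) (setLIntegral_le_lintegral (B ×ˢ B) _)
  have hae := SobolevTilde.ae_eq_zero hp hΩ.measurableSet hu.exterior
  have h1 : ∀ᵐ z : EuclideanSpace ℝ (Fin n) × EuclideanSpace ℝ (Fin n),
      z.1 ∉ Ω → (u - f) z.1 = 0 := Measure.quasiMeasurePreserving_fst.ae hae
  have h2 : ∀ᵐ z : EuclideanSpace ℝ (Fin n) × EuclideanSpace ℝ (Fin n),
      z.2 ∉ Ω → (u - f) z.2 = 0 := Measure.quasiMeasurePreserving_snd.ae hae
  have hac : energyMeasure σ ≪ volume :=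
    (withDensity_absolutelyContinuous _ _).trans (withDensity_absolutelyContinuous _ _)
  refine setLIntegral_congr_fun_ae (hB.prod hB) ?_
  filter_upwards [hac.ae_le h1, hac.ae_le h2] with z h1 h2 hz
  have e1 := h1 (Set.disjoint_left.1 hBΩ hz.1)
  have e2 := h2 (Set.disjoint_left.1 hBΩ hz.2)
  rw [Pi.sub_apply, sub_eq_zero] at e1 e2
  simp only [fracGrad, e1, e2]

end Solution

section Concentration

variable {n : ℕ} {s p : ℝ}

/-- Normalized test functions supported in a given ball. -/
theorem exists_testFun_sobolevNorm_eq_one (hn : 1 ≤ n) (hs0 : 0 < s) (hs1 : s < 1) (hp : 1 < p)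
    (x₀ : EuclideanSpace ℝ (Fin n)) {ε : ℝ} (hε : 0 < ε) :
    ∃ f ∈ TestFun (Metric.ball x₀ ε), sobolevNorm s p f = 1 := by
  have hp0 : 0 < p := by linarith
  let b : ContDiffBump x₀ := ⟨ε / 4, ε / 2, by positivity, by linarith⟩
  have hb : (b : EuclideanSpace ℝ (Fin n) → ℝ) ∈ TestFun (Metric.ball x₀ ε) := by
    refine ⟨b.contDiff, b.hasCompactSupport, ?_⟩
    rw [b.tsupport_eq]
    exact Metric.closedBall_subset_ball (by simp only [b]; linarith)
  have hbS := TestFun.mem_sobolevSpace hn hs0 hs1 hp hb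
  have hpow := sobolevNorm_rpow (s := s) hp (b : EuclideanSpace ℝ (Fin n) → ℝ)
  set N := sobolevNorm s p (b : EuclideanSpace ℝ (Fin n) → ℝ) with hN
  have hN0 : N ≠ 0 := by
    intro h0
    rw [h0, ENNReal.zero_rpow_of_pos hp0, eq_comm, add_eq_zero, ENNReal.rpow_eq_zero_iff_of_pos hp0,
      eLpNorm_eq_zero_iff hbS.1.1 (by simpa using hp0)] at hpow
    have h1 := (Continuous.ae_eq_iff_eq volume b.continuous continuous_zero).1 hpow.1
    have h2 : b x₀ = 1 := b.one_of_mem_closedBall (by simp [b]; positivity)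
    rw [h1] at h2
    simp at h2
  have hNt : N ≠ ⊤ := by
    intro h0
    rw [h0, ENNReal.top_rpow_of_pos hp0, eq_comm, ENNReal.add_eq_top] at hpow
    rcases hpow with h | h
    · exact (ENNReal.rpow_lt_top_of_nonneg hp0.le hbS.1.2.ne).ne h
    · exact (ENNReal.rpow_lt_top_of_nonneg hp0.le hbS.2.ne).ne h
  refine ⟨N.toReal⁻¹ • (b : EuclideanSpace ℝ (Fin n) → ℝ), TestFun.const_smul hb _, ?_⟩
  rw [sobolevNorm_const_smul hp, ← hN, Real.enorm_eq_ofReal (by positivity),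
    ENNReal.ofReal_inv_of_pos (ENNReal.toReal_pos hN0 hNt), ENNReal.ofReal_toReal hNt,
    ENNReal.inv_mul_cancel hN0 hNt]

/-- The Dirichlet-to-Neumann map on concentrated exterior data recovers the diagonal of the
coefficient. -/
theorem exists_forall_abs_dnMap_sub_le (hn : 1 ≤ n) (hs0 : 0 < s) (hs1 : s < 1) (hp : 1 < p)
    {Ω W : Set (EuclideanSpace ℝ (Fin n))} (hΩ : IsOpen Ω) (hΩb : Bornology.IsBounded Ω)
    (hW : IsOpen W) (hWΩ : W ⊆ (closure Ω)ᶜ)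
    {σ : EuclideanSpace ℝ (Fin n) → EuclideanSpace ℝ (Fin n) → ℝ} (hσ : Admissible W σ)
    {x₀ : EuclideanSpace ℝ (Fin n)} (hx₀ : x₀ ∈ W) {η : ℝ} (hη : 0 < η) :
    ∀ᶠ ε in 𝓝[>] (0 : ℝ), ∀ f ∈ TestFun (Metric.ball x₀ ε), sobolevNorm s p f = 1 →
      |dnMap s p Ω σ f f - σ x₀ x₀| ≤ η := by
  have hp0 : 0 < p := by linarith
  obtain ⟨c, hc⟩ := hσ.exists_isElliptic
  set τ := σ x₀ x₀ with hτ
  have hτ0 : 0 < τ := hc.pos.trans_le (hc.le _ _)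
  set η' := min (η / 2) τ with hη'
  have hη'0 : 0 < η' := lt_min (by positivity) hτ0
  have hη'1 : η' ≤ η / 2 := min_le_left _ _
  have hη'2 : η' ≤ τ := min_le_right _ _
  obtain ⟨δ, hδ, hδσ⟩ : ∃ δ > 0, ∀ x ∈ Metric.ball x₀ δ, x ∈ W ∧ |σ x x₀ - τ| ≤ η' / 2 ∧
      ∀ y, |σ y x - σ y x₀| ≤ η' / 2 := by
    have h1 := hσ.equicontinuous x₀ hx₀ _ (Metric.dist_mem_uniformity (half_pos hη'0))
    rw [hW.nhdsWithin_eq hx₀] at h1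
    have h2 := (hσ.continuous x₀ hx₀).continuousAt (hW.mem_nhds hx₀)
    have h3 := Metric.tendsto_nhds.1 h2 _ (half_pos hη'0)
    obtain ⟨δ, hδ, hb⟩ := Metric.eventually_nhds_iff_ball.1
      ((hW.eventually_mem hx₀).and (h3.and h1))
    refine ⟨δ, hδ, fun x hx => ?_⟩
    obtain ⟨hb1, hb2, hb3⟩ := hb x hx
    refine ⟨hb1, ?_, fun y => ?_⟩
    · rw [Real.dist_eq] at hb2
      exact hb2.le
    · have h4 : dist (σ y x₀) (σ y x) < η' / 2 := hb3 y
      rw [dist_comm, Real.dist_eq] at h4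
      exact h4.le
  set B := Metric.ball x₀ δ with hB
  have hBW : B ⊆ W := fun x hx => (hδσ x hx).1
  have hBm : MeasurableSet B := Metric.isOpen_ball.measurableSet
  have hBΩ : Disjoint B Ω := Set.disjoint_left.2 fun x hx hxΩ => hWΩ (hBW hx) (subset_closure hxΩ)
  have hBB : ∀ z ∈ B ×ˢ B, τ - η' ≤ σ z.1 z.2 ∧ σ z.1 z.2 ≤ τ + η' := by
    rintro ⟨x, y⟩ ⟨hx, hy⟩
    have h1 := abs_le.1 (hδσ x hx).2.1
    have h2 := abs_le.1 ((hδσ y hy).2.2 x)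
    constructor <;> simp only <;> linarith
  obtain ⟨C, hC, hfar⟩ := exists_lintegral_fracGrad_far_le (n := n) hs0 hp hδ
  obtain ⟨P, hP, hpoin⟩ := exists_poincare hn s hp
  set K := τ * (C + 1) + c⁻¹ * C with hK
  have hcinv : 0 < c⁻¹ := inv_pos.2 hc.pos
  have hsmall : ∀ᶠ ε in 𝓝[>] (0 : ℝ), K * (P * ε ^ (s * p)) ≤ η / 2 := by
    have h1 : Continuous fun ε : ℝ => K * (P * ε ^ (s * p)) :=
      continuous_const.mul (continuous_const.mul
        (continuous_id.rpow_const fun _ => Or.inr (by positivity)))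
    have h2 := (h1.tendsto 0).mono_left (nhdsWithin_le_nhds (s := Set.Ioi 0))
    rw [Real.zero_rpow (by positivity), mul_zero, mul_zero] at h2
    exact h2.eventually_le_const (by positivity)
  have hle : ∀ᶠ ε in 𝓝[>] (0 : ℝ), ε ≤ δ / 2 :=
    nhdsWithin_le_nhds (eventually_le_nhds (by positivity))
  filter_upwards [hsmall, hle, self_mem_nhdsWithin] with ε hεK hεδ hε0 f hf hf1
  have hε : 0 < ε := hε0
  have hfS := TestFun.mem_sobolevSpace hn hs0 hs1 hp hf
  have hfm := hf.1.continuous.measurable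
  have hf0 : ∀ x ∉ Metric.ball x₀ ε, f x = 0 := fun x hx => TestFun.eq_zero hf hx
  have hsol : IsWeakSolution s p Ω σ f (solution s p Ω σ f) :=
    Classical.epsilon_spec (exists_isWeakSolution hn hs0 hs1 hp hΩb hc hfS)
  have hdn : dnMap s p Ω σ f f = _ := hsol.weakForm_self hn hs0 hs1 hp hc hfS
  rw [hdn]
  have hup := ENNReal.ofReal_le_ofReal (hsol.energy_le hn hs0 hs1 hp hc hfS)
  have hlow := hsol.setLIntegral_le_energy hp hΩ hc hBm hBΩ
  set E := ∫ z, |fracGrad s (solution s p Ω σ f) z| ^ p ∂(energyMeasure σ) with hE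
  have hE0 : 0 ≤ E := integral_nonneg fun z => by positivity
  have hlow' := (hc.le_setLIntegral_energyMeasure (hBm.prod hBm) (fun z hz => (hBB z hz).1)
    fun z => ENNReal.ofReal (|fracGrad s f z| ^ p)).trans hlow
  rw [ofReal_integral_abs_rpow hp (hc.memLp_fracGrad hp hfS), eLpNorm_rpow_eq_lintegral hp,
    ← lintegral_add_compl _ (hBm.prod hBm)] at hup
  have hup' := hup.trans (add_le_add
    (hc.setLIntegral_energyMeasure_le (hBm.prod hBm) (fun z hz => (hBB z hz).2) _)
    (hc.setLIntegral_energyMeasure_le (hBm.prod hBm).compl (fun z _ => hc.le_inv z.1 z.2) _))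
  have hsplit : gagliardo s p f ^ p =
      ∫⁻ z in B ×ˢ B, ENNReal.ofReal (|fracGrad s f z| ^ p) ∂(offDiagMeasure n) +
      ∫⁻ z in (B ×ˢ B)ᶜ, ENNReal.ofReal (|fracGrad s f z| ^ p) ∂(offDiagMeasure n) := by
    rw [gagliardo, eLpNorm_rpow_eq_lintegral hp, lintegral_add_compl _ (hBm.prod hBm)]
  have hone := sobolevNorm_rpow (s := s) hp f
  rw [hf1, ENNReal.one_rpow, hsplit] at hone
  have hH := hfar x₀ ε (by linarith) f hfm hf0
  have hl := hpoin x₀ ε hε f hfm hf0 hs0.le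
  rw [hsplit] at hl
  generalize (∫⁻ z in B ×ˢ B, ENNReal.ofReal (|fracGrad s f z| ^ p) ∂(offDiagMeasure n)) = g at *
  generalize (∫⁻ z in (B ×ˢ B)ᶜ, ENNReal.ofReal (|fracGrad s f z| ^ p) ∂(offDiagMeasure n)) = h at *
  generalize eLpNorm f (ENNReal.ofReal p) volume ^ p = l at *
  have hfin : l + (g + h) ≠ ⊤ := by rw [← hone]; exact ENNReal.one_ne_top
  rw [ENNReal.add_ne_top, ENNReal.add_ne_top] at hfin
  obtain ⟨hlt, hgt, hht⟩ := hfin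
  lift l to NNReal using hlt
  lift g to NNReal using hgt
  lift h to NNReal using hht
  have hP0 : 0 ≤ P * ε ^ (s * p) := by positivity
  have r1 : (l : ℝ) + (g + h) = 1 := by exact_mod_cast hone.symm
  have r2 : (h : ℝ) ≤ C * l := by
    rw [← ENNReal.ofReal_coe_nnreal, ← ENNReal.ofReal_coe_nnreal, ← ENNReal.ofReal_mul hC,
      ENNReal.ofReal_le_ofReal_iff (by positivity)] at hH
    exact hH
  have r3 : (l : ℝ) ≤ P * ε ^ (s * p) * (g + h) := by
    rw [← ENNReal.coe_add, ← ENNReal.ofReal_coe_nnreal, ← ENNReal.ofReal_coe_nnreal,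
      ← ENNReal.ofReal_mul hP0, ENNReal.ofReal_le_ofReal_iff (by positivity)] at hl
    exact_mod_cast hl
  have r4 : (τ - η') * g ≤ E := by
    rw [← ENNReal.ofReal_coe_nnreal, ← ENNReal.ofReal_mul (by linarith),
      ENNReal.ofReal_le_ofReal_iff hE0] at hlow'
    exact hlow'
  have r5 : E ≤ (τ + η') * g + c⁻¹ * h := by
    rw [← ENNReal.ofReal_coe_nnreal, ← ENNReal.ofReal_coe_nnreal, ← ENNReal.ofReal_mul (by positivity),
      ← ENNReal.ofReal_mul (by positivity), ← ENNReal.ofReal_add (by positivity) (by positivity),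
      ENNReal.ofReal_le_ofReal_iff (by positivity)] at hup'
    exact hup'
  have hl0 : (0 : ℝ) ≤ l := l.2
  have hg0 : (0 : ℝ) ≤ g := g.2
  have hh0 : (0 : ℝ) ≤ h := h.2
  set κ := P * ε ^ (s * p) with hκ
  have r6 : (l : ℝ) ≤ κ := r3.trans (mul_le_of_le_one_right hP0 (by linarith))
  have r7 : K * l ≤ η / 2 :=
    (mul_le_mul_of_nonneg_left r6 (by positivity)).trans hεK
  have r8 : τ * ((C + 1) * l) + c⁻¹ * (C * l) ≤ η / 2 := by
    refine le_trans (le_of_eq ?_) r7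
    rw [hK]
    ring
  have r9 : c⁻¹ * h ≤ c⁻¹ * (C * l) := by gcongr
  have r10 : 0 ≤ c⁻¹ * (C * l) := by positivity
  have r11 : 0 ≤ τ * ((C + 1) * l) := by positivity
  rw [abs_le]
  constructor
  · have h1 : 1 - (C + 1) * l ≤ (g : ℝ) := by linarith
    have h2 := mul_le_mul_of_nonneg_left h1 (sub_nonneg.2 hη'2)
    have h3 : 0 ≤ η' * ((C + 1) * l) := by positivity
    linarith
  · have h1 : (τ + η') * g ≤ (τ + η') * 1 := by
      gcongr
      linarith
    linarith

end Concentration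

end FracPLap

theorem proposition1p3 (n : ℕ) (hn : 1 ≤ n) (s p : ℝ) (hs0 : 0 < s) (hs1 : s < 1) (hp : 1 < p)
    (Ω W : Set (EuclideanSpace ℝ (Fin n)))
    (hΩ : IsOpen Ω) (hΩb : Bornology.IsBounded Ω)
    (hW : IsOpen W) (hWne : W.Nonempty) (hWΩ : W ⊆ (closure Ω)ᶜ)
    (σ₁ σ₂ : EuclideanSpace ℝ (Fin n) → EuclideanSpace ℝ (Fin n) → ℝ)
    (hσ₁ : FracPLap.Admissible W σ₁) (hσ₂ : FracPLap.Admissible W σ₂) :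
    eLpNorm (fun x => σ₁ x x - σ₂ x x) ⊤ (volume.restrict W) ≤
      FracPLap.operatorNorm s p W
        (fun f g => FracPLap.dnMap s p Ω σ₁ f g - FracPLap.dnMap s p Ω σ₂ f g) := by
  open FracPLap Filter Topology in
  rw [eLpNorm_exponent_top]
  refine eLpNormEssSup_le_of_ae_enorm_bound (ae_restrict_of_forall_mem hW.measurableSet fun x₀ hx₀ => ?_)
  refine ENNReal.le_of_forall_pos_le_add fun η hη _ => ?_
  have hη2 : (0 : ℝ) < η / 2 := by positivity
  obtain ⟨ε, h1, h2, ⟨r, hr, hrW⟩, hε⟩ :=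
    ((exists_forall_abs_dnMap_sub_le hn hs0 hs1 hp hΩ hΩb hW hWΩ hσ₁ hx₀ hη2).and
      ((exists_forall_abs_dnMap_sub_le hn hs0 hs1 hp hΩ hΩb hW hWΩ hσ₂ hx₀ hη2).and
        ((show ∀ᶠ ε in 𝓝[>] (0 : ℝ), ∃ r, ε ≤ r ∧ Metric.ball x₀ r ⊆ W by
          obtain ⟨r, hr, hrW⟩ := Metric.isOpen_iff.1 hW x₀ hx₀
          exact nhdsWithin_le_nhds ((eventually_le_nhds hr).mono fun ε hε => ⟨r, hε, hrW⟩)).and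
            self_mem_nhdsWithin))).exists
  obtain ⟨f, hf, hf1⟩ := exists_testFun_sobolevNorm_eq_one hn hs0 hs1 hp x₀ hε
  have hfW : f ∈ TestFun W := ⟨hf.1, hf.2.1, hf.2.2.trans ((Metric.ball_subset_ball hr).trans hrW)⟩
  have hft : f ∈ {f | f ∈ SobolevTilde s p W ∧ sobolevNorm s p f ≤ 1} :=
    ⟨TestFun.mem_sobolevTilde hn hs0 hs1 hp hfW, hf1.le⟩
  have hop : ‖dnMap s p Ω σ₁ f f - dnMap s p Ω σ₂ f f‖ₑ ≤ operatorNorm s p W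
      (fun f g => dnMap s p Ω σ₁ f g - dnMap s p Ω σ₂ f g) := by
    refine le_trans ?_ (le_iSup₂ (f := fun f _ => dualNorm s p W
      (fun g => dnMap s p Ω σ₁ f g - dnMap s p Ω σ₂ f g)) f hft)
    exact le_iSup₂ (f := fun g _ => ‖dnMap s p Ω σ₁ f g - dnMap s p Ω σ₂ f g‖ₑ) f hft
  refine le_trans ?_ (add_le_add_left hop _)
  rw [Real.enorm_eq_ofReal_abs, Real.enorm_eq_ofReal_abs, ← ENNReal.ofReal_coe_nnreal,
    ← ENNReal.ofReal_add (abs_nonneg _) η.coe_nonneg]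
  refine ENNReal.ofReal_le_ofReal ?_
  have h1' := abs_le.1 (h1 f hf hf1)
  have h2' := abs_le.1 (h2 f hf hf1)
  have h3 := abs_le.1 (le_refl |dnMap s p Ω σ₁ f f - dnMap s p Ω σ₂ f f|)
  rw [abs_le]
  constructor <;> linarith
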